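/- Let $d\ge 1$, let $P\subset\mathbb{R}^{d^2}$ be a polytope that is combinatorially equivalent to the $d$-fold product of $d$-simplices (isomorphic face lattices), and let $\pi:\mathbb{R}^{d^2}\to\mathbb{R}^d$ be a surjective linear map under which every vertex of $P$ is strictly preserved. Here a proper face $F$ of a polytope $P$ is *strictly preserved* under $\pi$ if $\pi(F)$ is a face of $\pi(P)$, $\pi(F)$ is combinatorially isomorphic to $F$, and $P\cap\pi^{-1}(\pi(F))=F$. Let $q:\mathbb{R}^{d^2-d}\to\mathbb{R}^{d^2}$ be an injective linear map with image $\ker\pi$, and let $q^*$ be the dual map. Terminology: vectors $g_j$ $(j\in J)$ are *positively spanning* if every vector of the ambient space is a non-negative combination of them, and *positively dependent* if $0$ lies in the relative interior of their convex hull. A configuration $G=(g_1,\dots,g_m)$ is a *Gale transform* if for every $i$ the configuration $(g_j)_{j\neq i}$ is positively spanning. A full-dimensional polytope $A\subset\mathbb{R}^{k}$ with $m$ distinct vertices $a_1,\dots,a_m$ *has Gale transform $G$* if for every non-empty $J\subseteq\{1,\dots,m\}$ the set $\operatorname{conv}\{a_i : i\notin J\}$ is a face of $A$ if and only if $\{g_j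 : j\in J\}$ is positively dependent. Then $P$ has non-empty interior. Moreover, for every interior point $x_0$ of $P$ (used as the origin), the dual polytope $P^{\Delta}=\{\ell\in(\mathbb{R}^{d^2})^* : \ell(x-x_0)\le 1 \text{ for all } x\in P\}$ has exactly $m=d(d+1)$ vertices, and these can be listed as $\ell_1,\dots,\ell_m$ such that the following hold. 1. The projected dual vertex configuration $G=(q^*(\ell_1),\dots,q^*(\ell_m))$ is a Gale transform, and there is a $(2d-1)$-dimensional polytope $A(P,\pi)\subset\mathbb{R}^{2d-1}$ with $d(d+1)$ vertices that has Gale transform $G$ (the *associated polytope*). 2. After an arbitrarily small perturbation of the facets of $P$, the associated polytope can be taken to be simplicial. That is, for every $\varepsilon>0$ there are linear functionals $\ell_1',\dots,\ell_m'$ with $\|\ell_i'-\ell_i\|<\varepsilon$ for all $i$ such that: - $P'=\{x : \ell_i'(x-x_0)\le 1 \text{ for all } i\}$ is a polytope, and $\ell_1',\dots,\ell_m'$ are precisely the (pairwise distinct) vertices of the dual of $P'$ with respect to $x_0$; - $P'$ is combinatorially equivalent to $P$ by an isomorphism of face lattices under which each face of $P$ and its image have the same index set of tight inequalities; - every vertex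 of $P'$ is strictly preserved under $\pi$; - $G'=(q^*(\ell_1'),\dots,q^*(\ell_m'))$ is a Gale transform, and there is a *simplicial* $(2d-1)$-dimensional polytope $A(P',\pi)\subset\mathbb{R}^{2d-1}$ with $d(d+1)$ vertices that has Gale transform $G'$. -/

import Mathlib

open Set

section Polytopes

variable {E F : Type*} [NormedAddCommGroup E] [NormedSpace ℝ E]
  [NormedAddCommGroup F] [NormedSpace ℝ F]

/-- A (convex) polytope: the convex hull of finitely many points. -/
def IsPolytope (P : Set E) : Prop :=
  ∃ S : Set E, S.Finite ∧ P = convexHull ℝ S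

/-- The poset (lattice) of faces of `P`, ordered by inclusion. The faces are the empty set and the
sets of maximizers over `P` of the linear functionals, so that `P` itself is a face. -/
abbrev FaceLattice (P : Set E) : Type _ := {A : Set E // IsExposed ℝ P A}

/-- Combinatorial equivalence (or isomorphism): the face lattices are isomorphic. -/
def CombEquiv (P : Set E) (Q : Set F) : Prop :=
  Nonempty (FaceLattice P ≃o FaceLattice Q)

/-- The vertices: the points `v` such that `{v}` is a face. -/
abbrev vertexSet (P : Set E) : Set E := P.exposedPoints ℝ

/-- A polytope is simplicial if all its proper faces are simplices, that is, the vertices of each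
proper face are affinely independent. -/
def IsSimplicial (P : Set E) : Prop :=
  ∀ A : Set E, IsExposed ℝ P A → A ≠ P →
    AffineIndependent ℝ (fun v : vertexSet A => (v : E))

/-- The standard `r`-fold Cartesian product of `n`-simplices. -/
def simplexProduct (r n : ℕ) : Set (Fin r → Fin (n + 1) → ℝ) :=
  Set.univ.pi fun _ => stdSimplex ℝ (Fin (n + 1))

/-- The proper face `A` of `P` is strictly preserved under `π : P → π(P)`. -/
structure StrictlyPreserved (π : E →L[ℝ] F) (P A : Set E) : Prop where
  isFace : IsExposed ℝ P A
  proper : A ≠ P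
  image_isFace : IsExposed ℝ (π '' P) (π '' A)
  image_combEquiv : CombEquiv A (π '' A)
  preimage_eq : P ∩ π ⁻¹' (π '' A) = A

/-- All vertices of `P` are (strictly) preserved under `π`. -/
def PreservesVertices (π : E →L[ℝ] F) (P : Set E) : Prop :=
  ∀ v ∈ vertexSet P, StrictlyPreserved π P {v}

/-- The polar dual of `P`, where the point `x₀` plays the role of the origin. -/
def polarDual (P : Set E) (x₀ : E) : Set (StrongDual ℝ E) :=
  {l | ∀ x ∈ P, l (x - x₀) ≤ 1}

/-- `l` lists the vertices of the dual polytope (the facets of `P`), without repetition. -/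
def EnumeratesDualVertices {ι : Type*} (P : Set E) (x₀ : E) (l : ι → StrongDual ℝ E) : Prop :=
  Function.Injective l ∧ range l = vertexSet (polarDual P x₀)

/-- The polyhedron with the inequalities `l i (x - x₀) ≤ 1`. -/
def polyhedron {ι : Type*} (x₀ : E) (l : ι → StrongDual ℝ E) : Set E :=
  {x | ∀ i, l i (x - x₀) ≤ 1}

/-- The index set `I(A)` of a face `A`: the indices of those inequalities which are tight
on all of `A`. -/
def tightSet {ι : Type*} (x₀ : E) (l : ι → StrongDual ℝ E) (A : Set E) : Set ι :=
  {i | ∀ x ∈ A, l i (x - x₀) = 1}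

/-- `P`, with facets labelled by `l`, and `P'`, with facets labelled by `l'`, are combinatorially
equivalent in a way that respects the labels. -/
def LabelledCombEquiv {ι : Type*} (x₀ : E) (P : Set E) (l : ι → StrongDual ℝ E)
    (P' : Set E) (l' : ι → StrongDual ℝ E) : Prop :=
  ∃ φ : FaceLattice P ≃o FaceLattice P',
    ∀ A : FaceLattice P, tightSet x₀ l' (φ A : Set E) = tightSet x₀ l (A : Set E)

/-- The image `q^* ∘ l` of a configuration of linear functionals under the map `q^*` dual
to `q`. -/
def projectedConfig {ι : Type*} (q : F →L[ℝ] E) (l : ι → StrongDual ℝ E) :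
    ι → StrongDual ℝ F :=
  fun i => (l i).comp q

end Polytopes

section Gale

variable {ι V W : Type*} [NormedAddCommGroup V] [NormedSpace ℝ V]
  [NormedAddCommGroup W] [NormedSpace ℝ W]

/-- The vectors `g j`, `j ∈ J`, are positively spanning: every vector is a combination of them
with non-negative coefficients. -/
def PositivelySpanning (g : ι → V) (J : Finset ι) : Prop :=
  ∀ x : V, ∃ c : ι → ℝ, (∀ j ∈ J, 0 ≤ c j) ∧ ∑ j ∈ J, c j • g j = x

/-- The vectors `g j`, `j ∈ J`, are positively dependent: `0` is in the relative interior of their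
convex hull. -/
def PositivelyDependent (g : ι → V) (J : Finset ι) : Prop :=
  (0 : V) ∈ intrinsicInterior ℝ (convexHull ℝ (g '' (J : Set ι)))

/-- A finite configuration is a Gale transform if it is still positively spanning after the removal
of any one of its members. -/
def IsGaleTransform [Fintype ι] [DecidableEq ι] (g : ι → V) : Prop :=
  ∀ i : ι, PositivelySpanning g (Finset.univ.erase i)

/-- The points `a i` are the pairwise distinct vertices of a full-dimensional polytope whose Gale
transform is `g`: the vertices outside a (non-empty) index set `J` span a face if and only if the
vectors in `J` are positively dependent. (For empty `J` the face would be the whole polytope.) -/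
structure IsGaleDual (g : ι → V) (a : ι → W) : Prop where
  fullDim : (interior (convexHull ℝ (range a))).Nonempty
  injective : Function.Injective a
  vertices : vertexSet (convexHull ℝ (range a)) = range a
  face_iff : ∀ J : Finset ι, J.Nonempty →
    (IsExposed ℝ (convexHull ℝ (range a)) (convexHull ℝ (a '' (J : Set ι)ᶜ)) ↔
      PositivelyDependent g J)

end Gale

/-! Everything is reduced to an incidence pattern. The face lattice isomorphism yields points `v f`
of `P`, one for each choice of an index in every simplex factor, and supporting functionals `l s`
such that `l s` is tight at `v f` exactly when `s.2 ≠ f s.1` (`CombEquiv.exists_incidence`). With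
the dimension count this pattern, `IsVertexSystem`, determines the rest: at each `v f` the tight
functionals and the edge vectors are biorthogonal, so the edges form a basis and generate the cone
of feasible directions. Hence the convex hull of the `v f`, the faces, the dual vertices and vertex
preservation are all read off from strict inequalities on edges.

The Gale property comes from `exists_ne_pos_apply`. Given a facet `s` and a nonzero `w` in the
kernel of `π`, take a vertex off `s`. If no functional other than `l s` were positive on `w`, then
`w` would be a feasible direction there. A functional pulled back along `π` that exposes the image
of this vertex is negative on such directions, yet it vanishes on `w`. Separation turns this into
positive spanning after any deletion.

The associated polytope is built by linear duality (`IsGaleTransform.exists_isGaleDual`). After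
positive rescaling, the linear dependencies of `G` form a space containing the constants; points are
chosen whose affine functions are exactly this space. Faces are then zero sets of its nonnegative
members. If `G` is in general position, proper faces are simplices.

For the perturbation, `q^*` is surjective, so any displacement of `G` lifts to the facets.
Displacement along a moment curve gives general position for all but finitely many parameters, and a
vertex system with its strict edge inequalities survives small changes of `l`. -/

section LinearAlgebra

variable {E : Type*} [NormedAddCommGroup E] [NormedSpace ℝ E]

theorem affineSpan_eq_top_of_forall_dual {s : Set E} (hs : s.Nonempty)
    (h : ∀ φ : E →ₗ[ℝ] ℝ, (∀ x ∈ s, ∀ y ∈ s, φ x = φ y) → φ = 0) : affineSpan ℝ s = ⊤ := by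
  rw [AffineSubspace.affineSpan_eq_top_iff_vectorSpan_eq_top_of_nonempty ℝ E E hs]
  by_contra hne
  obtain ⟨φ, hφ, hle⟩ := Submodule.exists_le_ker_of_lt_top _ (lt_top_iff_ne_top.2 hne)
  refine hφ (h φ fun x hx y hy => ?_)
  have := hle (vsub_mem_vectorSpan ℝ hx hy)
  rw [LinearMap.mem_ker, vsub_eq_sub, map_sub] at this
  linarith

/-- Biorthogonality makes `e` linearly independent, the cardinality makes it a basis, and each `l s`
then reads off its own coefficient. -/
theorem sum_smul_eq_of_biorthogonal [FiniteDimensional ℝ E] {τ : Type*} [Fintype τ]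
    (hτ : Fintype.card τ = Module.finrank ℝ E) (l : τ → StrongDual ℝ E) (e : τ → E)
    (h0 : ∀ s t, s ≠ t → l s (e t) = 0) (h1 : ∀ s, l s (e s) ≠ 0) (x : E) :
    ∑ s, (l s x / l s (e s)) • e s = x := by
  classical
  have hli : LinearIndependent ℝ e := by
    rw [Fintype.linearIndependent_iff]
    intro c hc s
    have := congrArg (l s) hc
    rw [map_sum, map_zero, Finset.sum_eq_single s] at this
    · simpa [h1 s] using this
    · intro t _ hts
      rw [map_smul, h0 s t hts.symm, smul_zero]
    · simp
  obtain ⟨c, rfl⟩ := (Submodule.mem_span_range_iff_exists_fun ℝ).1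
    ((hli.span_eq_top_of_card_eq_finrank' hτ).symm ▸ Submodule.mem_top (x := x))
  refine Finset.sum_congr rfl fun s _ => ?_
  congr 1
  rw [map_sum, Finset.sum_eq_single s]
  · rw [map_smul, smul_eq_mul, mul_div_cancel_right₀ _ (h1 s)]
  · intro t _ hts
    rw [map_smul, h0 s t hts.symm, smul_zero]
  · simp

theorem exists_eq_eval [FiniteDimensional ℝ E] (L : StrongDual ℝ E →ₗ[ℝ] ℝ) :
    ∃ w, ∀ m : StrongDual ℝ E, L m = m w := by
  refine ⟨(Module.evalEquiv ℝ E).symm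
    (L ∘ₗ LinearMap.toContinuousLinearMap.toLinearMap), fun m => ?_⟩
  have := Module.apply_evalEquiv_symm_apply ℝ E m.toLinearMap
    (L ∘ₗ LinearMap.toContinuousLinearMap.toLinearMap)
  rw [ContinuousLinearMap.coe_coe] at this
  rw [this]
  rfl

end LinearAlgebra

section Exposed

variable {E : Type*} [NormedAddCommGroup E] [NormedSpace ℝ E]

theorem exists_le_of_mem_convexHull_range {τ : Type*} {a : τ → E} {x : E}
    (hx : x ∈ convexHull ℝ (range a)) (m : StrongDual ℝ E) : ∃ i, m x ≤ m (a i) := by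
  by_contra! h
  have : convexHull ℝ (range a) ⊆ {y | m y < m x} :=
    convexHull_min (range_subset_iff.2 h) (convex_halfSpace_lt m.toLinearMap.isLinear _)
  exact lt_irrefl (m x) (this hx)

theorem le_of_mem_convexHull_range {τ : Type*} {a : τ → E} {x : E}
    (hx : x ∈ convexHull ℝ (range a)) (m : StrongDual ℝ E) {M : ℝ} (h : ∀ i, m (a i) ≤ M) :
    m x ≤ M :=
  (exists_le_of_mem_convexHull_range hx m).elim fun i hi => hi.trans (h i)

end Exposed

/-! ### Vertex systems: edge bases and feasible cones -/

/-- The points `v f` are related to the functionals `l s` as the vertices of a product of simplices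
are to its facets: `v f` lies on the hyperplane `l (i, j) = 1` if and only if `j ≠ f i`, and
strictly below it otherwise. -/
structure IsVertexSystem {ι κ E : Type*} [NormedAddCommGroup E] [NormedSpace ℝ E]
    (x₀ : E) (l : ι × κ → StrongDual ℝ E) (v : (ι → κ) → E) : Prop where
  tight : ∀ f s, s.2 ≠ f s.1 → l s (v f - x₀) = 1
  slack : ∀ f s, s.2 = f s.1 → l s (v f - x₀) < 1

namespace IsVertexSystem

variable {ι κ E F : Type*} [NormedAddCommGroup E] [NormedSpace ℝ E]
  [NormedAddCommGroup F] [NormedSpace ℝ F]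
  {x₀ : E} {l : ι × κ → StrongDual ℝ E} {v : (ι → κ) → E}

theorem le_one (h : IsVertexSystem x₀ l v) (f : ι → κ) (s : ι × κ) : l s (v f - x₀) ≤ 1 := by
  by_cases hs : s.2 = f s.1
  · exact (h.slack f s hs).le
  · exact (h.tight f s hs).le

theorem mem_polyhedron (h : IsVertexSystem x₀ l v) (f : ι → κ) : v f ∈ polyhedron x₀ l :=
  h.le_one f

theorem injective_config [Nontrivial κ] (h : IsVertexSystem x₀ l v) : Function.Injective l := by
  classical
  intro s t hst
  by_contra hne
  obtain ⟨f, hfs, hft⟩ : ∃ f : ι → κ, s.2 = f s.1 ∧ t.2 ≠ f t.1 := by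
    by_cases h1 : s.1 = t.1
    · refine ⟨fun _ => s.2, rfl, fun h2 => hne (Prod.ext h1 h2.symm)⟩
    · obtain ⟨k, hk⟩ := exists_ne t.2
      exact ⟨Function.update (fun _ => k) s.1 s.2, by simp, by
        rw [Function.update_of_ne (Ne.symm h1)]; exact hk.symm⟩
  have h1 := h.slack f s hfs
  rw [hst, h.tight f t hft] at h1
  exact lt_irrefl _ h1

theorem card_tight [Fintype ι] [Fintype κ] [DecidableEq κ] (f : ι → κ) :
    Fintype.card {s : ι × κ // s.2 ≠ f s.1} = Fintype.card ι * (Fintype.card κ - 1) := by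
  have e : {s : ι × κ // s.2 ≠ f s.1} ≃ Σ i : ι, {j : κ // j ≠ f i} :=
    { toFun := fun s => ⟨s.1.1, s.1.2, s.2⟩
      invFun := fun s => ⟨(s.1, s.2.1), s.2.2⟩
      left_inv := fun _ => rfl
      right_inv := fun _ => rfl }
  rw [Fintype.card_congr e, Fintype.card_sigma]
  simp [Fintype.card_subtype_compl]

theorem apply_sub_nonpos (h : IsVertexSystem x₀ l v) {f : ι → κ} {x : E}
    (hx : x ∈ polyhedron x₀ l) (s : ι × κ) (hs : s.2 ≠ f s.1) : l s (x - v f) ≤ 0 := by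
  have h1 := hx s
  have h2 := h.tight f s hs
  rw [← sub_sub_sub_cancel_right _ _ x₀, map_sub]
  linarith

variable [DecidableEq ι]

/-- The edge vector leaving the vertex `v f` in the direction in which only the inequality `s` stops
being tight. -/
def edge (v : (ι → κ) → E) (f : ι → κ) (s : ι × κ) : E := v (Function.update f s.1 s.2) - v f

/-- Passing to the neighbour along `t` can only destroy the tightness of `t`, so `s` is tight at
both ends of the edge. -/
theorem apply_edge_of_ne (h : IsVertexSystem x₀ l v) {f : ι → κ} {s t : ι × κ}
    (hs : s.2 ≠ f s.1) (hst : s ≠ t) : l s (edge v f t) = 0 := by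
  have h1 := h.tight f s hs
  have h2 : l s (v (Function.update f t.1 t.2) - x₀) = 1 := by
    apply h.tight
    by_cases h1 : s.1 = t.1
    · rw [h1, Function.update_self]
      exact fun h2 => hst (Prod.ext h1 h2)
    · rwa [Function.update_of_ne h1]
  rw [edge, ← sub_sub_sub_cancel_right _ _ x₀, map_sub, h1, h2, sub_self]

theorem apply_edge_self (h : IsVertexSystem x₀ l v) {f : ι → κ} {s : ι × κ}
    (hs : s.2 ≠ f s.1) : l s (edge v f s) < 0 := by
  have h1 := h.tight f s hs
  have h2 := h.slack (Function.update f s.1 s.2) s (by rw [Function.update_self])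
  rw [edge, ← sub_sub_sub_cancel_right _ _ x₀, map_sub, h1]
  linarith

section FiniteDimensional

variable [Fintype ι] [Fintype κ] [DecidableEq κ] [FiniteDimensional ℝ E]

theorem sum_edge (h : IsVertexSystem x₀ l v)
    (hE : Module.finrank ℝ E = Fintype.card ι * (Fintype.card κ - 1)) (f : ι → κ) (x : E) :
    ∑ s : {s : ι × κ // s.2 ≠ f s.1}, (l s.1 x / l s.1 (edge v f s.1)) • edge v f s.1 = x :=
  sum_smul_eq_of_biorthogonal ((card_tight f).trans hE.symm) (fun s => l s.1)
    (fun s => edge v f s.1)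
    (fun s _ hst => h.apply_edge_of_ne s.2 fun h' => hst (Subtype.ext h'))
    (fun s => (h.apply_edge_self s.2).ne) x

theorem apply_eq_sum (h : IsVertexSystem x₀ l v)
    (hE : Module.finrank ℝ E = Fintype.card ι * (Fintype.card κ - 1)) (f : ι → κ) (x : E)
    (m : E →ₗ[ℝ] ℝ) :
    m x = ∑ s : {s : ι × κ // s.2 ≠ f s.1},
      l s.1 x / l s.1 (edge v f s.1) * m (edge v f s.1) := by
  conv_lhs => rw [← h.sum_edge hE f x, map_sum]
  simp only [map_smul, smul_eq_mul]

/-- Each coefficient of `x` in the edge basis is a nonpositive number divided by a negative one, so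
`x` lies in the cone generated by the edges. -/
theorem le_zero_of_edge (h : IsVertexSystem x₀ l v)
    (hE : Module.finrank ℝ E = Fintype.card ι * (Fintype.card κ - 1)) {f : ι → κ} {x : E}
    (hx : ∀ s : ι × κ, s.2 ≠ f s.1 → l s x ≤ 0) (m : E →ₗ[ℝ] ℝ)
    (hm : ∀ s : ι × κ, s.2 ≠ f s.1 → m (edge v f s) ≤ 0) : m x ≤ 0 := by
  rw [h.apply_eq_sum hE f x m]
  exact Finset.sum_nonpos fun s _ => mul_nonpos_of_nonneg_of_nonpos
    (div_nonneg_of_nonpos (hx s.1 s.2) (h.apply_edge_self s.2).le) (hm s.1 s.2)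

theorem exists_of_edge_eq_zero (h : IsVertexSystem x₀ l v)
    (hE : Module.finrank ℝ E = Fintype.card ι * (Fintype.card κ - 1)) {f : ι → κ} {x : E}
    (hx : ∀ s : ι × κ, s.2 ≠ f s.1 → l s x ≤ 0) (m : E →ₗ[ℝ] ℝ)
    (hm : ∀ s : ι × κ, s.2 ≠ f s.1 → m (edge v f s) ≤ 0) (h0 : m x = 0)
    {s : ι × κ} (hs : s.2 ≠ f s.1) (hms : m (edge v f s) ≠ 0) : l s x = 0 := by
  rw [h.apply_eq_sum hE f x m, Finset.sum_eq_zero_iff_of_nonpos fun s _ =>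
    mul_nonpos_of_nonneg_of_nonpos
      (div_nonneg_of_nonpos (hx s.1 s.2) (h.apply_edge_self s.2).le) (hm s.1 s.2)] at h0
  have := h0 ⟨s, hs⟩ (Finset.mem_univ _)
  simpa [hms, (h.apply_edge_self hs).ne] using this

theorem eq_zero_of_forall_tight (h : IsVertexSystem x₀ l v)
    (hE : Module.finrank ℝ E = Fintype.card ι * (Fintype.card κ - 1)) (f : ι → κ) {x : E}
    (hx : ∀ s : ι × κ, s.2 ≠ f s.1 → l s x = 0) : x = 0 := by
  rw [← h.sum_edge hE f x]
  exact Finset.sum_eq_zero fun s _ => by rw [hx s.1 s.2, zero_div, zero_smul]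

/-- A functional that is negative on all edges at `v f` is negative on every nonzero vector of the
cone of feasible directions at `v f`. -/
theorem lt_zero_of_edge (h : IsVertexSystem x₀ l v)
    (hE : Module.finrank ℝ E = Fintype.card ι * (Fintype.card κ - 1)) {f : ι → κ} {x : E}
    (hx : ∀ s : ι × κ, s.2 ≠ f s.1 → l s x ≤ 0) (hx0 : x ≠ 0) (m : E →ₗ[ℝ] ℝ)
    (hm : ∀ s : ι × κ, s.2 ≠ f s.1 → m (edge v f s) < 0) : m x < 0 := by
  refine (h.le_zero_of_edge hE hx m fun s hs => (hm s hs).le).lt_of_ne fun h0 => hx0 ?_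
  exact h.eq_zero_of_forall_tight hE f fun s hs =>
    h.exists_of_edge_eq_zero hE hx m (fun s hs => (hm s hs).le) h0 hs (hm s hs).ne

/-- Local optimality is global: a functional maximal at `v f` among the finitely many vertices is
nonpositive on the edges there, hence maximal at `v f` over the whole polyhedron. No functional can
therefore separate a point of the polyhedron from the hull of the vertices. -/
theorem polyhedron_eq (h : IsVertexSystem x₀ l v)
    (hE : Module.finrank ℝ E = Fintype.card ι * (Fintype.card κ - 1)) [Nonempty κ] :
    polyhedron x₀ l = convexHull ℝ (range v) := by
  apply Subset.antisymm
  · intro x hx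
    by_contra hxn
    obtain ⟨m, u, hm, hu⟩ := geometric_hahn_banach_closed_point (convex_convexHull ℝ (range v))
      ((Set.finite_range v).isClosed_convexHull (𝕜 := ℝ)) hxn
    obtain ⟨f, hf⟩ := Finite.exists_max fun f => m (v f)
    have := h.le_zero_of_edge hE (f := f) (x := x - v f) (h.apply_sub_nonpos hx) m.toLinearMap
      fun s _ => by simpa [edge] using hf _
    have h2 := hm _ (subset_convexHull ℝ _ (mem_range_self f))
    simp only [ContinuousLinearMap.coe_coe, map_sub] at this
    linarith
  · refine convexHull_min (range_subset_iff.2 h.mem_polyhedron) ?_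
    have : polyhedron x₀ l = ⋂ s, {x | l s x ≤ 1 + l s x₀} := by
      ext x
      simp [polyhedron]
    rw [this]
    exact convex_iInter fun s => convex_halfSpace_le (l s).toLinearMap.isLinear _

end FiniteDimensional

end IsVertexSystem

/-- A point has only two faces, itself and the empty set. The set-builder form transports both to
another point by one formula. -/
theorem isExposed_singleton_sep {E F : Type*} [NormedAddCommGroup F] [NormedSpace ℝ F]
    (x : E) (y : F) (A : Set E) : IsExposed ℝ {y} {z | z = y ∧ x ∈ A} := by
  by_cases hx : x ∈ A
  · simpa [hx] using IsExposed.refl (𝕜 := ℝ) ({y} : Set F)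
  · simpa [hx] using isExposed_empty (𝕜 := ℝ) (A := ({y} : Set F))

theorem CombEquiv.singleton {E F : Type*} [NormedAddCommGroup E] [NormedSpace ℝ E]
    [NormedAddCommGroup F] [NormedSpace ℝ F] (x : E) (y : F) : CombEquiv {x} {y} := by
  refine ⟨Equiv.toOrderIso
    { toFun := fun A => ⟨_, isExposed_singleton_sep x y A.1⟩
      invFun := fun A => ⟨_, isExposed_singleton_sep y x A.1⟩
      left_inv := ?_
      right_inv := ?_ } ?_ ?_⟩
  · rintro ⟨A, hA⟩
    ext z
    simp only [mem_ofPred_eq, true_and]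
    refine ⟨fun hz => hz.1 ▸ hz.2, fun hz => ?_⟩
    obtain rfl := hA.subset hz
    exact ⟨rfl, hz⟩
  · rintro ⟨A, hA⟩
    ext z
    simp only [mem_ofPred_eq, true_and]
    refine ⟨fun hz => hz.1 ▸ hz.2, fun hz => ?_⟩
    obtain rfl := hA.subset hz
    exact ⟨rfl, hz⟩
  · exact fun A B hAB z hz => ⟨hz.1, hAB hz.2⟩
  · exact fun A B hAB z hz => ⟨hz.1, hAB hz.2⟩

/-! ### Faces cut out by tight inequalities -/

section TightFace

variable {τ E : Type*} [NormedAddCommGroup E] [NormedSpace ℝ E]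

/-- The face of the polyhedron on which the inequalities indexed by `I` are tight. -/
def tightFace (x₀ : E) (l : τ → StrongDual ℝ E) (I : Set τ) : Set E :=
  {x ∈ polyhedron x₀ l | ∀ s ∈ I, l s (x - x₀) = 1}

/-- The sum of the functionals in `I` is maximal exactly where every summand is, once some point `w`
attains all the bounds together. -/
theorem isExposed_tightFace [Fintype τ] (x₀ : E) (l : τ → StrongDual ℝ E) (I : Set τ) :
    IsExposed ℝ (polyhedron x₀ l) (tightFace x₀ l I) := by
  classical
  rintro ⟨w, hw⟩
  refine ⟨∑ s with s ∈ I, l s, Subset.antisymm (fun x hx => ⟨hx.1, fun y hy => ?_⟩)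
    fun x hx => ⟨hx.1, fun s hs => ?_⟩⟩
  · simp only [sum_apply]
    refine Finset.sum_le_sum fun s hs => ?_
    have h1 := hy s
    have h2 := hx.2 s (by simpa using hs)
    rw [map_sub] at h1 h2
    linarith
  · have hle : ∀ t ∈ Finset.univ.filter (· ∈ I), l t x ≤ l t w := by
      intro t ht
      have h1 := hx.1 t
      have h2 := hw.2 t (by simpa using ht)
      rw [map_sub] at h1 h2
      linarith
    have hsum := hx.2 w hw.1
    simp only [sum_apply] at hsum
    have := (Finset.sum_eq_sum_iff_of_le hle).1 ((Finset.sum_le_sum hle).antisymm hsum) s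
      (by simpa using hs)
    rw [map_sub, this, ← map_sub, hw.2 s hs]

theorem config_mem_polarDual (x₀ : E) (l : τ → StrongDual ℝ E) (s : τ) :
    l s ∈ polarDual (polyhedron x₀ l) x₀ :=
  fun _ hx => hx s

theorem mem_interior_polyhedron [Finite τ] (x₀ : E) (l : τ → StrongDual ℝ E) :
    x₀ ∈ interior (polyhedron x₀ l) := by
  have hopen : IsOpen (⋂ s, {x | l s (x - x₀) < 1}) := isOpen_iInter_of_finite fun s =>
    isOpen_lt ((l s).continuous.comp (continuous_id.sub continuous_const)) continuous_const
  refine interior_maximal (fun x hx s => ?_) hopen (by simp)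
  exact (mem_iInter.1 hx s : l s (x - x₀) < 1).le

end TightFace

/-! ### Face lattice, dual vertices and projection of a vertex system -/

namespace IsVertexSystem

variable {ι κ E F : Type*} [NormedAddCommGroup E] [NormedSpace ℝ E]
  [NormedAddCommGroup F] [NormedSpace ℝ F]
  {x₀ : E} {l : ι × κ → StrongDual ℝ E} {v : (ι → κ) → E}
  [DecidableEq ι]

/-- The condition on `I` says that it contains all indices (the empty face) or is tight at some
vertex. For `s ∉ I`, switching `f` to `s.2` in the block of `s` gives a vertex still in the face, at
which `s` is slack. -/
theorem tightSet_tightFace (h : IsVertexSystem x₀ l v)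
    {I : Set (ι × κ)} (hI : I = univ ∨ ∃ f : ι → κ, ∀ i, (i, f i) ∉ I) :
    tightSet x₀ l (tightFace x₀ l I) = I := by
  refine Subset.antisymm (fun s hs => ?_) fun s hs x hx => hx.2 s hs
  rcases hI with rfl | ⟨f, hf⟩
  · trivial
  · by_contra hsI
    let g := Function.update f s.1 s.2
    have hg : ∀ i, (i, g i) ∉ I := by
      intro i
      by_cases hi : i = s.1
      · subst hi
        simpa [g] using hsI
      · simpa [g, Function.update_of_ne hi] using hf i
    have hmem : v g ∈ tightFace x₀ l I := by
      refine ⟨h.mem_polyhedron g, fun t ht => h.tight g t fun h1 => hg t.1 ?_⟩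
      rwa [← h1]
    exact (h.slack g s (by simp [g])).ne (hs _ hmem)

variable [Fintype ι] [Fintype κ] [DecidableEq κ] [FiniteDimensional ℝ E]

theorem isPolytope_polyhedron (h : IsVertexSystem x₀ l v)
    (hE : Module.finrank ℝ E = Fintype.card ι * (Fintype.card κ - 1)) [Nonempty κ] :
    IsPolytope (polyhedron x₀ l) :=
  ⟨range v, Set.finite_range v, h.polyhedron_eq hE⟩

theorem exists_vertex_mem (h : IsVertexSystem x₀ l v)
    (hE : Module.finrank ℝ E = Fintype.card ι * (Fintype.card κ - 1)) [Nonempty κ]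
    {A : Set E} (hA : IsExposed ℝ (polyhedron x₀ l) A) (hne : A.Nonempty) : ∃ f, v f ∈ A := by
  obtain ⟨m, hm⟩ := hA hne
  obtain ⟨x, hx⟩ := hne
  rw [hm] at hx
  obtain ⟨f, hf⟩ := exists_le_of_mem_convexHull_range (h.polyhedron_eq hE ▸ hx.1) m
  exact ⟨f, hm ▸ ⟨h.mem_polyhedron f, fun y hy => (hx.2 y hy).trans hf⟩⟩

theorem tightFace_vertex (h : IsVertexSystem x₀ l v)
    (hE : Module.finrank ℝ E = Fintype.card ι * (Fintype.card κ - 1)) (f : ι → κ) :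
    tightFace x₀ l {s | s.2 ≠ f s.1} = {v f} := by
  refine Subset.antisymm (fun x hx => ?_)
    (singleton_subset_iff.2 ⟨h.mem_polyhedron f, fun s hs => h.tight f s hs⟩)
  refine sub_eq_zero.1 (h.eq_zero_of_forall_tight hE f fun s hs => ?_)
  have h1 := hx.2 s hs
  have h2 := h.tight f s hs
  rw [← sub_sub_sub_cancel_right _ _ x₀, map_sub, h1, h2, sub_self]

theorem vertexSet_polyhedron (h : IsVertexSystem x₀ l v)
    (hE : Module.finrank ℝ E = Fintype.card ι * (Fintype.card κ - 1)) [Nonempty κ] :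
    vertexSet (polyhedron x₀ l) = range v := by
  ext x
  rw [mem_exposedPoints_iff_exposed_singleton]
  constructor
  · intro hx
    obtain ⟨f, hf⟩ := h.exists_vertex_mem hE hx (singleton_nonempty x)
    exact ⟨f, hf⟩
  · rintro ⟨f, rfl⟩
    rw [← h.tightFace_vertex hE f]
    exact isExposed_tightFace x₀ l _

theorem eq_tightFace_tightSet (h : IsVertexSystem x₀ l v)
    (hE : Module.finrank ℝ E = Fintype.card ι * (Fintype.card κ - 1)) [Nonempty ι] [Nonempty κ]
    {A : Set E} (hA : IsExposed ℝ (polyhedron x₀ l) A) :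
    tightFace x₀ l (tightSet x₀ l A) = A := by
  refine Subset.antisymm (fun x hx => ?_) fun x hx => ⟨hA.subset hx, fun s hs => hs x hx⟩
  rcases A.eq_empty_or_nonempty with rfl | hne
  · exfalso
    have hx1 : ∀ s, l s (x - x₀) = 1 := fun s => hx.2 s (by simp [tightSet])
    let f : ι → κ := fun _ => Classical.arbitrary κ
    have : x ∈ tightFace x₀ l {s | s.2 ≠ f s.1} := ⟨hx.1, fun s _ => hx1 s⟩
    rw [h.tightFace_vertex hE f, mem_singleton_iff] at this
    obtain ⟨i⟩ := ‹Nonempty ι›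
    exact (h.slack f (i, f i) rfl).ne (this ▸ hx1 _)
  · obtain ⟨f, hf⟩ := h.exists_vertex_mem hE hA hne
    obtain ⟨m, hm⟩ := hA hne
    have hf' := hm ▸ hf
    have hedge : ∀ s : ι × κ, s.2 ≠ f s.1 → m.toLinearMap (edge v f s) ≤ 0 := fun s _ => by
      simpa [edge] using hf'.2 _ (h.mem_polyhedron (Function.update f s.1 s.2))
    -- An edge on which the exposing functional drops cannot contribute to a point of `A`, so its
    -- inequality is tight on `A`. The remaining edges leave `m` unchanged, which is why tightness
    -- on these indices already forces maximality.
    have key : ∀ s : ι × κ, s.2 ≠ f s.1 → m (edge v f s) < 0 → s ∈ tightSet x₀ l A := by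
      intro s hs hms y hy
      have hy' := hm ▸ hy
      have := h.exists_of_edge_eq_zero hE (h.apply_sub_nonpos hy'.1) m.toLinearMap hedge
        (by simpa [sub_eq_zero] using (hf'.2 y hy'.1).antisymm (hy'.2 _ hf'.1)) hs hms.ne
      rw [← sub_sub_sub_cancel_right _ _ x₀, map_sub, h.tight f s hs] at this
      linarith
    have hmx : m (x - v f) = 0 := by
      have := h.apply_eq_sum hE f (x - v f) m.toLinearMap
      rw [ContinuousLinearMap.coe_coe] at this
      rw [this]
      refine Finset.sum_eq_zero fun s _ => ?_
      rcases (hedge s.1 s.2).lt_or_eq with hlt | heq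
      · have h1 := hx.2 s.1 (key s.1 s.2 hlt)
        have h2 := h.tight f s.1 s.2
        rw [← sub_sub_sub_cancel_right _ _ x₀, map_sub, h1, h2, sub_self, zero_div, zero_mul]
      · rw [ContinuousLinearMap.coe_coe] at heq
        rw [heq, mul_zero]
    rw [hm]
    refine ⟨hx.1, fun y hy => (hf'.2 y hy).trans ?_⟩
    rw [map_sub] at hmx
    linarith

theorem tightSet_eq_univ_or (h : IsVertexSystem x₀ l v)
    (hE : Module.finrank ℝ E = Fintype.card ι * (Fintype.card κ - 1)) [Nonempty κ]
    {A : Set E} (hA : IsExposed ℝ (polyhedron x₀ l) A) :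
    tightSet x₀ l A = univ ∨ ∃ f : ι → κ, ∀ i, (i, f i) ∉ tightSet x₀ l A := by
  rcases A.eq_empty_or_nonempty with rfl | hne
  · left
    simp [tightSet]
  · right
    obtain ⟨f, hf⟩ := h.exists_vertex_mem hE hA hne
    exact ⟨f, fun i hi => (h.slack f (i, f i) rfl).ne (hi _ hf)⟩

/-- Faces correspond to their index sets, and the criterion for being such a set mentions only the
incidence pattern, which both systems share. -/
theorem labelledCombEquiv (h : IsVertexSystem x₀ l v)
    (hE : Module.finrank ℝ E = Fintype.card ι * (Fintype.card κ - 1)) [Nonempty ι] [Nonempty κ]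
    {l' : ι × κ → StrongDual ℝ E} {v' : (ι → κ) → E} (h' : IsVertexSystem x₀ l' v') :
    LabelledCombEquiv x₀ (polyhedron x₀ l) l (polyhedron x₀ l') l' := by
  refine ⟨Equiv.toOrderIso
    { toFun := fun A => ⟨_, isExposed_tightFace x₀ l' (tightSet x₀ l A.1)⟩
      invFun := fun A => ⟨_, isExposed_tightFace x₀ l (tightSet x₀ l' A.1)⟩
      left_inv := ?_
      right_inv := ?_ } ?_ ?_, ?_⟩
  · intro A
    apply Subtype.ext
    simp only
    rw [h'.tightSet_tightFace (h.tightSet_eq_univ_or hE A.2), h.eq_tightFace_tightSet hE A.2]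
  · intro A
    apply Subtype.ext
    simp only
    rw [h.tightSet_tightFace (h'.tightSet_eq_univ_or hE A.2), h'.eq_tightFace_tightSet hE A.2]
  · exact fun A B hAB x hx => ⟨hx.1, fun s hs => hx.2 s fun y hy => hs y (hAB hy)⟩
  · exact fun A B hAB x hx => ⟨hx.1, fun s hs => hx.2 s fun y hy => hs y (hAB hy)⟩
  · exact fun A => h'.tightSet_tightFace (h.tightSet_eq_univ_or hE A.2)

theorem mem_polarDual (h : IsVertexSystem x₀ l v)
    (hE : Module.finrank ℝ E = Fintype.card ι * (Fintype.card κ - 1)) [Nonempty κ]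
    {m : StrongDual ℝ E} : m ∈ polarDual (polyhedron x₀ l) x₀ ↔ ∀ f, m (v f - x₀) ≤ 1 := by
  refine ⟨fun hm f => hm _ (h.mem_polyhedron f), fun hm x hx => ?_⟩
  obtain ⟨f, hf⟩ := exists_le_of_mem_convexHull_range (h.polyhedron_eq hE ▸ hx) m
  have := hm f
  rw [map_sub] at this ⊢
  linarith

/-- The polyhedron is bounded, so one of its inequalities limits the movement in any given
direction. -/
theorem exists_pos_apply (h : IsVertexSystem x₀ l v)
    (hE : Module.finrank ℝ E = Fintype.card ι * (Fintype.card κ - 1)) [Nonempty κ]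
    {w : E} (hw : w ≠ 0) : ∃ s, 0 < l s w := by
  by_contra! hle
  have hbdd : Bornology.IsBounded (polyhedron x₀ l) := by
    rw [h.polyhedron_eq hE]
    exact isBounded_convexHull.2 (Set.finite_range v).isBounded
  obtain ⟨R, hR⟩ := hbdd.exists_norm_le
  have hmem : ∀ t : ℝ, 0 ≤ t → x₀ + t • w ∈ polyhedron x₀ l := by
    intro t ht s
    rw [add_sub_cancel_left, map_smul, smul_eq_mul]
    exact (mul_nonpos_of_nonneg_of_nonpos ht (hle s)).trans zero_le_one
  have hR0 : 0 ≤ R := (norm_nonneg _).trans (hR _ (hmem 0 le_rfl))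
  have hw' : 0 < ‖w‖ := norm_pos_iff.2 hw
  have h1 := hR _ (hmem ((R + ‖x₀‖ + 1) / ‖w‖) (by positivity))
  have h2 := norm_sub_le (x₀ + ((R + ‖x₀‖ + 1) / ‖w‖) • w) x₀
  rw [add_sub_cancel_left, norm_smul, Real.norm_of_nonneg (by positivity),
    div_mul_cancel₀ _ hw'.ne'] at h2
  linarith

theorem enumeratesDualVertices (h : IsVertexSystem x₀ l v)
    (hE : Module.finrank ℝ E = Fintype.card ι * (Fintype.card κ - 1)) [Nonempty ι] [Nontrivial κ] :
    EnumeratesDualVertices (polyhedron x₀ l) x₀ l := by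
  refine ⟨h.injective_config, Subset.antisymm ?_ ?_⟩
  · rintro _ ⟨s, rfl⟩
    refine ⟨config_mem_polarDual x₀ l s,
      -- The exposing direction is the sum of the vertices on facet `s`. A dual point `m` reaching
      -- the same value equals 1 at each of them, so it vanishes on all edges at one such vertex
      -- except the edge leaving the facet. It is thus proportional to `l s`, with factor 1.
      ContinuousLinearMap.apply ℝ ℝ (∑ f : ι → κ with s.2 ≠ f s.1, (v f - x₀)), fun m hm => ?_⟩
    have hm1 := (h.mem_polarDual hE).1 hm
    have hle : ∀ f ∈ Finset.univ.filter (fun f : ι → κ => s.2 ≠ f s.1),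
        m (v f - x₀) ≤ l s (v f - x₀) := fun f hf => by
      rw [h.tight f s (by simpa using hf)]
      exact hm1 f
    simp only [map_sum, sum_apply, ContinuousLinearMap.apply_apply]
    refine ⟨Finset.sum_le_sum hle, fun hsum => ?_⟩
    have heq : ∀ f : ι → κ, s.2 ≠ f s.1 → m (v f - x₀) = 1 := fun f hf => by
      rw [(Finset.sum_eq_sum_iff_of_le hle).1 ((Finset.sum_le_sum hle).antisymm hsum) f
        (by simpa using hf), h.tight f s hf]
    obtain ⟨k, hk⟩ := exists_ne s.2
    let f : ι → κ := fun _ => k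
    have hf : s.2 ≠ f s.1 := hk.symm
    have hoff : ∀ t : ι × κ, t.2 ≠ f t.1 → t ≠ s → m (edge v f t) = 0 := by
      intro t ht hts
      have h1 : s.2 ≠ Function.update f t.1 t.2 s.1 := by
        by_cases h2 : s.1 = t.1
        · rw [h2, Function.update_self]
          exact fun h3 => hts (Prod.ext h2.symm h3.symm)
        · rwa [Function.update_of_ne h2]
      rw [edge, ← sub_sub_sub_cancel_right _ _ x₀, map_sub, heq _ h1, heq f hf, sub_self]
    ext x
    have hx := h.apply_eq_sum hE f x m.toLinearMap
    have hv := h.apply_eq_sum hE f (v f - x₀) m.toLinearMap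
    rw [Finset.sum_eq_single ⟨s, hf⟩ (fun t _ ht => by
      rw [ContinuousLinearMap.coe_coe, hoff t.1 t.2 fun h' => ht (Subtype.ext h'), mul_zero])
      (by simp), ContinuousLinearMap.coe_coe] at hx hv
    rw [heq f hf, h.tight f s hf] at hv
    rw [hx, div_mul_eq_mul_div, mul_div_assoc, ← one_div_mul_eq_div, ← hv, mul_one]
  · rintro m ⟨hm, L, hL⟩
    obtain ⟨w, hw⟩ := exists_eq_eval L.toLinearMap
    replace hw : ∀ m', L m' = m' w := hw
    simp only [hw] at hL
    obtain ⟨k⟩ : Nonempty κ := inferInstance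
    obtain ⟨i⟩ : Nonempty ι := inferInstance
    have : Nonempty (ι × κ) := ⟨(i, k)⟩
    -- The facet first hit by the ray from `x₀` in direction `w`. The exit point `x₀ + (l s w)⁻¹ •
    -- w` bounds every dual point by `l s w`.
    obtain ⟨s, hs⟩ := Finite.exists_max fun s => l s w
    refine ⟨s, (hL _ (config_mem_polarDual x₀ l s)).2 ?_⟩
    by_cases hw0 : w = 0
    · simp [hw0]
    · obtain ⟨t, ht⟩ := h.exists_pos_apply hE hw0
      have hpos : 0 < l s w := ht.trans_le (hs t)
      have hy : x₀ + (l s w)⁻¹ • w ∈ polyhedron x₀ l := by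
        intro t
        rw [add_sub_cancel_left, map_smul, smul_eq_mul, inv_mul_le_iff₀ hpos, mul_one]
        exact hs t
      have := hm _ hy
      rwa [add_sub_cancel_left, map_smul, smul_eq_mul, inv_mul_le_iff₀ hpos, mul_one] at this

/-- The pulled-back functional has `v f` as its unique maximizer, which gives both the image face
and its fibre. With the converse `exists_of_preservesVertices`, preservation becomes finitely many
strict inequalities, stable under perturbation. -/
theorem preservesVertices (h : IsVertexSystem x₀ l v)
    (hE : Module.finrank ℝ E = Fintype.card ι * (Fintype.card κ - 1)) [Nonempty ι] [Nontrivial κ]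
    (π : E →L[ℝ] F) (m : (ι → κ) → StrongDual ℝ F)
    (hm : ∀ f s, s.2 ≠ f s.1 → m f (π (edge v f s)) < 0) :
    PreservesVertices π (polyhedron x₀ l) := by
  intro x hx
  have hx' := hx
  rw [h.vertexSet_polyhedron hE] at hx
  obtain ⟨f, rfl⟩ := hx
  have key : ∀ y ∈ polyhedron x₀ l, y ≠ v f → m f (π y) < m f (π (v f)) := by
    intro y hy hne
    have := h.lt_zero_of_edge hE (h.apply_sub_nonpos hy) (sub_ne_zero.2 hne)
      ((m f).comp π).toLinearMap (hm f)
    simpa using this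
  refine ⟨mem_exposedPoints_iff_exposed_singleton.1 hx', ?_, ?_, ?_, ?_⟩
  · intro heq
    obtain ⟨i⟩ := ‹Nonempty ι›
    obtain ⟨k, hk⟩ := exists_ne (f i)
    have h1 : v (Function.update f i k) = v f := by
      have := h.mem_polyhedron (Function.update f i k)
      rwa [← heq] at this
    exact (h.slack (Function.update f i k) (i, k) (by simp)).ne (h1 ▸ h.tight f (i, k) hk)
  · rw [image_singleton, ← mem_exposedPoints_iff_exposed_singleton]
    refine ⟨mem_image_of_mem π (h.mem_polyhedron f), m f, ?_⟩
    rintro _ ⟨y, hy, rfl⟩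
    by_cases hyf : y = v f
    · simp [hyf]
    · exact ⟨(key y hy hyf).le, fun hle => absurd hle (key y hy hyf).not_ge⟩
  · rw [image_singleton]
    exact CombEquiv.singleton _ _
  · refine Subset.antisymm (fun y hy => ?_) ?_
    · by_contra hne
      have h1 := key y hy.1 hne
      have h2 := hy.2
      rw [image_singleton, mem_preimage, mem_singleton_iff] at h2
      rw [h2] at h1
      exact lt_irrefl _ h1
    · rw [singleton_subset_iff]
      exact ⟨h.mem_polyhedron f, mem_image_of_mem π rfl⟩

theorem exists_of_preservesVertices (h : IsVertexSystem x₀ l v)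
    (hE : Module.finrank ℝ E = Fintype.card ι * (Fintype.card κ - 1)) [Nonempty κ]
    {π : E →L[ℝ] F} (hπ : PreservesVertices π (polyhedron x₀ l)) (f : ι → κ) :
    ∃ m : StrongDual ℝ F, ∀ s, s.2 ≠ f s.1 → m (π (edge v f s)) < 0 := by
  have hp := hπ (v f) (h.vertexSet_polyhedron hE ▸ mem_range_self f)
  have h1 := hp.image_isFace
  rw [image_singleton, ← mem_exposedPoints_iff_exposed_singleton] at h1
  obtain ⟨-, m, hm⟩ := h1
  refine ⟨m, fun s hs => ?_⟩
  have hg := h.mem_polyhedron (Function.update f s.1 s.2)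
  have h2 := hm _ (mem_image_of_mem π hg)
  rw [edge, map_sub, map_sub, sub_neg]
  refine h2.1.lt_of_not_ge fun hle => ?_
  have h3 := h2.2 hle
  have h4 : v (Function.update f s.1 s.2) ∈ ({v f} : Set E) := by
    rw [← hp.preimage_eq]
    exact ⟨hg, by rw [image_singleton, mem_preimage, h3]; rfl⟩
  have h5 := h.slack (Function.update f s.1 s.2) s (by simp)
  rw [mem_singleton_iff.1 h4, h.tight f s hs] at h5
  exact lt_irrefl _ h5

theorem exists_ne_pos_apply (h : IsVertexSystem x₀ l v)
    (hE : Module.finrank ℝ E = Fintype.card ι * (Fintype.card κ - 1))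
    {π : E →L[ℝ] F} {m : (ι → κ) → StrongDual ℝ F}
    (hm : ∀ f s, s.2 ≠ f s.1 → m f (π (edge v f s)) < 0) {w : E} (hw : w ≠ 0) (hπw : π w = 0)
    (s : ι × κ) : ∃ t, t ≠ s ∧ 0 < l t w := by
  by_contra! hle
  -- A vertex at which `s` is not tight, so the unknown sign of `l s w` plays no role.
  let f : ι → κ := fun _ => s.2
  have := h.lt_zero_of_edge hE (f := f)
    (fun t ht => hle t fun hts => ht (by rw [hts])) hw ((m f).comp π).toLinearMap (hm f)
  simp [hπw] at this

end IsVertexSystem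

/-! ### Positive spanning and positive dependence -/

section PositiveSpanning

variable {ι V : Type*} [NormedAddCommGroup V] [NormedSpace ℝ V]

/-- The cone of the non-negative combinations of the vectors `g j`, `j ∈ J`. -/
def combCone (g : ι → V) (J : Finset ι) : Set V :=
  {x | ∃ c : ι → ℝ, (∀ j ∈ J, 0 ≤ c j) ∧ ∑ j ∈ J, c j • g j = x}

theorem convex_combCone (g : ι → V) (J : Finset ι) : Convex ℝ (combCone g J) := by
  rintro _ ⟨b, hb, rfl⟩ _ ⟨c, hc, rfl⟩ s t hs ht -
  refine ⟨fun j => s * b j + t * c j, fun j hj =>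
    add_nonneg (mul_nonneg hs (hb j hj)) (mul_nonneg ht (hc j hj)), ?_⟩
  simp only [add_smul, mul_smul, Finset.sum_add_distrib, Finset.smul_sum]

theorem smul_mem_combCone {g : ι → V} {J : Finset ι} {x : V} (hx : x ∈ combCone g J) {t : ℝ}
    (ht : 0 ≤ t) : t • x ∈ combCone g J := by
  obtain ⟨c, hc, rfl⟩ := hx
  exact ⟨fun j => t * c j, fun j hj => mul_nonneg ht (hc j hj), by
    simp only [mul_smul, Finset.smul_sum]⟩

theorem zero_mem_combCone (g : ι → V) (J : Finset ι) : (0 : V) ∈ combCone g J :=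
  ⟨0, by simp, by simp⟩

theorem mem_combCone {g : ι → V} {J : Finset ι} {j : ι} (hj : j ∈ J) : g j ∈ combCone g J := by
  classical
  refine ⟨Pi.single j 1, fun k _ => ?_, ?_⟩
  · by_cases hk : k = j
    · subst hk; simp
    · simp [hk]
  · rw [Finset.sum_eq_single j (fun k _ hk => by simp [hk]) (fun h => absurd hj h)]
    simp

theorem convexHull_subset_combCone (g : ι → V) (J : Finset ι) :
    convexHull ℝ (g '' (J : Set ι)) ⊆ combCone g J :=
  convexHull_min (image_subset_iff.2 fun _ hj => mem_combCone hj) (convex_combCone g J)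

/-- The cone is full-dimensional, and a hyperplane supporting it at 0 would contradict `h`. So 0 is
interior, and a cone containing a ball around 0 is everything. -/
theorem positivelySpanning_of_forall_dual [FiniteDimensional ℝ V] {g : ι → V} {J : Finset ι}
    (h : ∀ φ : StrongDual ℝ V, φ ≠ 0 → ∃ j ∈ J, 0 < φ (g j)) : PositivelySpanning g J := by
  have hspan : affineSpan ℝ (combCone g J) = ⊤ := by
    refine affineSpan_eq_top_of_forall_dual ⟨0, zero_mem_combCone g J⟩ fun φ hφ => ?_
    by_contra hne
    obtain ⟨j, hj, hpos⟩ := h (LinearMap.toContinuousLinearMap φ) (by simpa using hne)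
    have := hφ _ (mem_combCone hj) _ (zero_mem_combCone g J)
    rw [map_zero] at this
    exact hpos.ne' this
  have hint := (convex_combCone g J).interior_nonempty_iff_affineSpan_eq_top.2 hspan
  have h0 : (0 : V) ∈ interior (combCone g J) := by
    by_contra h0
    obtain ⟨φ, u, hφ, hle, hu⟩ := geometric_hahn_banach_of_nonempty_interior
      (convex_combCone g J) (convex_singleton (0 : V)) (disjoint_singleton_right.2 h0) hint
      (singleton_nonempty _)
    have hu0 : u ≤ 0 := by simpa using hu 0 rfl
    obtain ⟨j, hj, hpos⟩ := h φ hφ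
    exact hpos.not_ge ((hle _ (mem_combCone hj)).trans hu0)
  obtain ⟨ε, hε, hball⟩ := Metric.mem_nhds_iff.1 (mem_interior_iff_mem_nhds.1 h0)
  intro x
  set t : ℝ := ε / (2 * (‖x‖ + 1)) with ht
  have htpos : 0 < t := by positivity
  have hmem : t • x ∈ combCone g J := by
    refine hball ?_
    rw [mem_ball_zero_iff, norm_smul, Real.norm_of_nonneg htpos.le, ht, div_mul_eq_mul_div,
      div_lt_iff₀ (by positivity)]
    nlinarith [norm_nonneg x]
  have := smul_mem_combCone hmem (inv_nonneg.2 htpos.le)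
  rwa [smul_smul, inv_mul_cancel₀ htpos.ne', one_smul] at this

theorem exists_pos_of_positivelyDependent {g : ι → V} {J : Finset ι}
    (h : PositivelyDependent g J) :
    ∃ c : ι → ℝ, (∀ j ∈ J, 0 < c j) ∧ ∑ j ∈ J, c j • g j = 0 := by
  classical
  obtain ⟨y, hy, hy0⟩ := mem_intrinsicInterior.1 h
  obtain ⟨ε, hε, hball⟩ := Metric.mem_nhds_iff.1 (mem_interior_iff_mem_nhds.1 hy)
  have h0 : (0 : V) ∈ affineSpan ℝ (convexHull ℝ (g '' (J : Set ι))) := hy0 ▸ y.2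
  -- Since 0 is relatively interior, a small multiple of `-g j` stays in the hull; this gives a
  -- dependency positive at `j`. Summing over `j` makes all coefficients positive.
  have key : ∀ j ∈ J, ∃ c : ι → ℝ, (∀ k ∈ J, 0 ≤ c k) ∧ 0 < c j ∧ ∑ k ∈ J, c k • g k = 0 := by
    intro j hj
    set δ : ℝ := ε / (2 * (‖g j‖ + 1)) with hδ
    have hδpos : 0 < δ := by positivity
    have hmem : -(δ • g j) ∈ affineSpan ℝ (convexHull ℝ (g '' (J : Set ι))) := by
      have := AffineMap.lineMap_mem (-δ) h0
        (subset_affineSpan ℝ _ (subset_convexHull ℝ _ (mem_image_of_mem g hj)))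
      simpa [AffineMap.lineMap_apply] using this
    have hconv : -(δ • g j) ∈ convexHull ℝ (g '' (J : Set ι)) := by
      refine hball (a := ⟨_, hmem⟩) ?_
      rw [Metric.mem_ball, Subtype.dist_eq, hy0, dist_zero_right, norm_neg, norm_smul,
        Real.norm_of_nonneg hδpos.le, hδ, div_mul_eq_mul_div, div_lt_iff₀ (by positivity)]
      nlinarith [norm_nonneg (g j)]
    obtain ⟨c, hc, hsum⟩ := convexHull_subset_combCone g J hconv
    refine ⟨c + Pi.single j δ, fun k hk => ?_, ?_, ?_⟩
    · refine add_nonneg (hc k hk) ?_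
      by_cases hkj : k = j
      · subst hkj; simpa using hδpos.le
      · simp [hkj]
    · simpa using add_pos_of_nonneg_of_pos (hc j hj) hδpos
    · simp only [Pi.add_apply, add_smul, Finset.sum_add_distrib, hsum]
      rw [Finset.sum_eq_single j (fun k _ hk => by simp [hk]) (fun h => absurd hj h)]
      simp
  choose! c hc hpos hsum using key
  refine ⟨fun k => ∑ j ∈ J, c j k, fun j hj =>
    Finset.sum_pos' (fun i hi => hc i hi j hj) ⟨j, hj, hpos j hj⟩, ?_⟩
  simp only [Finset.sum_smul]
  rw [Finset.sum_comm]
  exact Finset.sum_eq_zero hsum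

theorem positivelyDependent_of_pos {g : ι → V} {J : Finset ι}
    (hJ : J.Nonempty) {c : ι → ℝ} (hc : ∀ j ∈ J, 0 < c j) (hsum : ∑ j ∈ J, c j • g j = 0) :
    PositivelyDependent g J := by
  classical
  set S := convexHull ℝ (g '' (J : Set ι)) with hS
  have hg : ∀ j ∈ J, g j ∈ S := fun j hj => subset_convexHull ℝ _ (mem_image_of_mem g hj)
  set C := ∑ j ∈ J, c j with hC
  have hCpos : 0 < C := Finset.sum_pos hc hJ
  -- The weight missing from `t` is spent on the combination with weights `c j / C`, whose value is
  -- 0. Small positive combinations thus lie in the hull, and they fill an open subset of the span.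
  have hmemS : ∀ t : J → ℝ, (∀ j, 0 < t j) → ∑ j, t j < 1 → ∑ j, t j • g j ∈ S := by
    intro t ht hlt
    have hw : ∀ j : J, 0 ≤ t j + (1 - ∑ j, t j) * (c j / C) := fun j =>
      add_nonneg (ht j).le (mul_nonneg (sub_nonneg.2 hlt.le) (div_nonneg (hc j j.2).le hCpos.le))
    have h1 : ∑ j : J, c j / C = 1 := by
      rw [← Finset.sum_div, Finset.sum_coe_sort J c, div_self hCpos.ne']
    have h2 : ∑ j : J, (c j / C) • g j = 0 := by
      rw [Finset.sum_coe_sort J fun j => (c j / C) • g j]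
      simp only [div_eq_inv_mul, mul_smul, ← Finset.smul_sum, hsum, smul_zero]
    have := (convex_convexHull ℝ (g '' (J : Set ι))).sum_mem (t := Finset.univ)
      (fun j _ => hw j) (by rw [Finset.sum_add_distrib, ← Finset.mul_sum, h1]; ring)
      (fun j _ => hg j.1 j.2)
    simp only [add_smul, mul_smul, Finset.sum_add_distrib, ← Finset.smul_sum, h2, smul_zero,
      add_zero] at this
    exact this
  set L := Submodule.span ℝ (range fun j : J => g j) with hL
  let T : (J → ℝ) →ₗ[ℝ] L :=
    LinearMap.codRestrict L (Fintype.linearCombination ℝ fun j : J => g j) fun t => by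
      rw [hL, ← Fintype.range_linearCombination]
      exact LinearMap.mem_range_self _ t
  have hTapp : ∀ t, (T t : V) = ∑ j, t j • g j := fun t => rfl
  have hT : Function.Surjective T := by
    rintro ⟨x, hx⟩
    rw [hL, ← Fintype.range_linearCombination ℝ] at hx
    obtain ⟨t, rfl⟩ := hx
    exact ⟨t, rfl⟩
  let U : Set (J → ℝ) := {t | (∀ j, 0 < t j) ∧ ∑ j, t j < 1}
  have hU : IsOpen U := by
    rw [show U = (⋂ j, {t | 0 < t j}) ∩ {t | ∑ j, t j < 1} by ext; simp [U]]
    exact (isOpen_iInter_of_finite fun j => isOpen_lt continuous_const (continuous_apply j)).inter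
      (isOpen_lt (continuous_finsetSum _ fun j _ => continuous_apply j) continuous_const)
  have : FiniteDimensional ℝ L := FiniteDimensional.span_of_finite ℝ (finite_range _)
  have hTU : IsOpen (T '' U) := T.isOpenMap_of_finiteDimensional hT U hU
  have h0TU : (0 : L) ∈ T '' U := by
    -- Dividing by twice the total makes the weights sum to 1/2, strictly below 1.
    refine ⟨fun j => c j / (C + C), ⟨fun j => div_pos (hc j j.2) (by linarith), ?_⟩, ?_⟩
    · rw [← Finset.sum_div, Finset.sum_coe_sort J c, ← hC, div_lt_one (by linarith)]
      linarith
    · apply Subtype.ext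
      rw [hTapp, Finset.sum_coe_sort J fun j => (c j / (C + C)) • g j]
      simp only [div_eq_inv_mul, mul_smul, ← Finset.smul_sum, hsum, smul_zero]
      rfl
  obtain ⟨ε, hε, hball⟩ := Metric.mem_nhds_iff.1 (hTU.mem_nhds h0TU)
  have hsub : ∀ x : V, x ∈ L → ‖x‖ < ε → x ∈ S := by
    intro x hx hlt
    obtain ⟨t, ht, htx⟩ := hball (a := (⟨x, hx⟩ : L)) (by simpa using hlt)
    have := congrArg Subtype.val htx
    rw [hTapp] at this
    rw [← show _ = x from this]
    exact hmemS t ht.1 ht.2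
  have h0S : (0 : V) ∈ S := hsub 0 (zero_mem _) (by simpa using hε)
  rw [PositivelyDependent, mem_intrinsicInterior]
  refine ⟨⟨0, subset_affineSpan ℝ _ h0S⟩, ?_, rfl⟩
  rw [mem_interior_iff_mem_nhds, Metric.mem_nhds_iff]
  refine ⟨ε, hε, fun x hx => hsub _ ?_ ?_⟩
  · have h1 : (x : V) ∈ affineSpan ℝ (g '' (J : Set ι)) := affineSpan_convexHull (𝕜 := ℝ) (g '' (J : Set ι)) ▸ x.2
    have h2 := affineSpan_subset_span h1
    rwa [hL, range_comp' g Subtype.val, Subtype.range_coe]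
  · simpa [Subtype.dist_eq] using hx

end PositiveSpanning

/-! ### Point configurations with prescribed affine functions -/

section GaleDuality

variable {ι V W : Type*} [NormedAddCommGroup V] [NormedSpace ℝ V]
  [NormedAddCommGroup W] [NormedSpace ℝ W]

/-- The functions on the points `a i` that are induced by affine functions on the ambient space
are exactly the members of `K`, and distinct affine functions induce distinct members. -/
structure RealizesAffineFunctions (K : Submodule ℝ (ι → ℝ)) (a : ι → W) : Prop where
  mem : ∀ (t : ℝ) (m : StrongDual ℝ W), (fun i => t + m (a i)) ∈ K
  exists_eq : ∀ c ∈ K, ∃ (t : ℝ) (m : StrongDual ℝ W), ∀ i, c i = t + m (a i)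
  eq_zero : ∀ (t : ℝ) (m : StrongDual ℝ W), (∀ i, m (a i) = t) → m = 0

/-- A complement of the constants in `K` has the dimension of the dual of `W`. After identifying the
two, evaluation at `i` is a functional on that dual, hence a point `a i`. -/
theorem exists_realizesAffineFunctions [Finite ι] [Nonempty ι] [FiniteDimensional ℝ W]
    {K : Submodule ℝ (ι → ℝ)} (h1 : (1 : ι → ℝ) ∈ K)
    (hK : Module.finrank ℝ K = Module.finrank ℝ W + 1) :
    ∃ a : ι → W, RealizesAffineFunctions K a := by
  have hu : (⟨1, h1⟩ : K) ≠ 0 := fun h => one_ne_zero (congrArg Subtype.val h)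
  obtain ⟨C, hC⟩ := Submodule.exists_isCompl (Submodule.span ℝ {(⟨1, h1⟩ : K)})
  have hCrank : Module.finrank ℝ (StrongDual ℝ W) = Module.finrank ℝ C := by
    have h2 := Submodule.finrank_add_eq_of_isCompl hC
    rw [finrank_span_singleton hu, hK] at h2
    rw [← LinearEquiv.finrank_eq (LinearMap.toContinuousLinearMap (𝕜 := ℝ) (E := W) (F' := ℝ)),
      Subspace.dual_finrank_eq]
    omega
  have : Module.Free ℝ C := Module.Free.of_divisionRing ℝ C
  let B : StrongDual ℝ W ≃ₗ[ℝ] C := LinearEquiv.ofFinrankEq _ _ hCrank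
  choose a ha using fun i : ι => exists_eq_eval
    (LinearMap.proj i ∘ₗ K.subtype ∘ₗ C.subtype ∘ₗ B.toLinearMap)
  have ha' : ∀ i m, m (a i) = ((B m : K) : ι → ℝ) i := fun i m => (ha i m).symm
  refine ⟨a, fun t m => ?_, fun c hc => ?_, fun t m hm => ?_⟩
  · have : (fun i => t + m (a i)) = t • (1 : ι → ℝ) + ((B m : K) : ι → ℝ) := by
      ext i
      simp [ha']
    rw [this]
    exact K.add_mem (K.smul_mem t h1) (B m : K).2
  · have hmem : (⟨c, hc⟩ : K) ∈ Submodule.span ℝ {(⟨1, h1⟩ : K)} ⊔ C :=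
      hC.sup_eq_top ▸ Submodule.mem_top
    obtain ⟨y, hy, z, hz, hyz⟩ := Submodule.mem_sup.1 hmem
    obtain ⟨t, rfl⟩ := Submodule.mem_span_singleton.1 hy
    refine ⟨t, B.symm ⟨z, hz⟩, fun i => ?_⟩
    have := congrFun (congrArg Subtype.val hyz) i
    simpa [ha'] using this.symm
  · have heq : (B m : K) = t • (⟨1, h1⟩ : K) := by
      apply Subtype.ext
      ext i
      simpa [ha'] using hm i
    have h0 : (B m : K) = 0 := Submodule.disjoint_def.1 hC.disjoint _
      (heq ▸ Submodule.smul_mem _ t (Submodule.mem_span_singleton_self _)) (B m).2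
    exact B.map_eq_zero_iff.1 (Subtype.ext h0)

/-- A convex combination attaining the bound can put weight only on points attaining it. -/
theorem convexHull_image_eq_of_le [Finite ι] (a : ι → W) (m : StrongDual ℝ W) {M : ℝ}
    (hM : ∀ i, m (a i) ≤ M) :
    {x ∈ convexHull ℝ (range a) | m x = M} = convexHull ℝ (a '' {i | m (a i) = M}) := by
  classical
  apply Subset.antisymm
  · rintro x ⟨hx, hxM⟩
    obtain ⟨κ, _, w, z, hw, hw1, hz, rfl⟩ := mem_convexHull_iff_exists_fintype.1 hx
    have hzM : ∀ k, m (z k) ≤ M := fun k => by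
      obtain ⟨i, hi⟩ := hz k
      exact hi ▸ hM i
    have hsum : ∑ k, w k * (M - m (z k)) = 0 := by
      simp only [map_sum, map_smul, smul_eq_mul] at hxM
      simp only [mul_sub, Finset.sum_sub_distrib, ← Finset.sum_mul, hw1, hxM, one_mul, sub_self]
    rw [Finset.sum_eq_zero_iff_of_nonneg fun k _ => mul_nonneg (hw k) (sub_nonneg.2 (hzM k))]
      at hsum
    rw [← Finset.sum_filter_of_ne (p := fun k => w k ≠ 0)
      fun k _ hk h0 => hk (by rw [h0, zero_smul])]
    refine (convex_convexHull ℝ _).sum_mem (fun k _ => hw k) ?_ fun k hk => ?_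
    · rw [Finset.sum_filter_ne_zero, hw1]
    · obtain ⟨i, hi⟩ := hz k
      have h0 := (mul_eq_zero.1 (hsum k (Finset.mem_univ k))).resolve_left
        (Finset.mem_filter.1 hk).2
      refine subset_convexHull ℝ _ ⟨i, ?_, hi⟩
      rw [mem_ofPred_eq, hi]
      linarith
  · refine fun x hx => ⟨convexHull_mono (image_subset_range _ _) hx, ?_⟩
    have : convexHull ℝ (a '' {i | m (a i) = M}) ⊆ {x | m x = M} :=
      convexHull_min (image_subset_iff.2 fun i hi => hi)
        (convex_hyperplane m.toLinearMap.isLinear _)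
    exact this hx

theorem exists_face_of_isExposed [Finite ι] {a : ι → W} {A : Set W}
    (hA : IsExposed ℝ (convexHull ℝ (range a)) A) (hne : A.Nonempty) :
    ∃ (M : ℝ) (m : StrongDual ℝ W), (∀ i, m (a i) ≤ M) ∧
      A = {x ∈ convexHull ℝ (range a) | m x = M} ∧ A = convexHull ℝ (a '' {i | m (a i) = M}) := by
  obtain ⟨m, hm⟩ := hA hne
  obtain ⟨x, hx⟩ := hne
  have hx' := hm ▸ hx
  have hle : ∀ i, m (a i) ≤ m x := fun i => hx'.2 _ (subset_convexHull ℝ _ (mem_range_self i))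
  have hA' : A = {y ∈ convexHull ℝ (range a) | m y = m x} := by
    rw [hm]
    exact Subset.antisymm (fun y hy => ⟨hy.1, (hx'.2 y hy.1).antisymm (hy.2 x hx'.1)⟩)
      fun y hy => ⟨hy.1, fun z hz => (hx'.2 z hz).trans hy.2.ge⟩
  exact ⟨m x, m, hle, hA', hA'.trans (convexHull_image_eq_of_le a m hle)⟩

theorem isExposed_of_le [Finite ι] (a : ι → W) (m : StrongDual ℝ W) {M : ℝ}
    (hM : ∀ i, m (a i) ≤ M) :
    IsExposed ℝ (convexHull ℝ (range a)) (convexHull ℝ (a '' {i | m (a i) = M})) := by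
  rw [← convexHull_image_eq_of_le a m hM]
  rintro ⟨x, hx, hxM⟩
  refine ⟨m, Subset.antisymm (fun y hy => ⟨hy.1, fun z hz => ?_⟩) fun y hy =>
    ⟨hy.1, (le_of_mem_convexHull_range hy.1 m hM).antisymm (hxM ▸ hy.2 x hx)⟩⟩
  exact (le_of_mem_convexHull_range hz m hM).trans hy.2.ge

namespace RealizesAffineFunctions

variable {K : Submodule ℝ (ι → ℝ)} {a : ι → W}

theorem notMem_convexHull (h : RealizesAffineFunctions K a)
    (hv : ∀ i, ∃ c ∈ K, c i = 0 ∧ ∀ j, j ≠ i → 0 < c j) {i : ι} {J : Set ι} (hi : i ∉ J) :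
    a i ∉ convexHull ℝ (a '' J) := by
  obtain ⟨c, hc, hci, hpos⟩ := hv i
  obtain ⟨t, m, hm⟩ := h.exists_eq c hc
  have hsub : convexHull ℝ (a '' J) ⊆ {x | -t < m x} := by
    refine convexHull_min (image_subset_iff.2 fun j hj => ?_)
      (convex_halfSpace_gt m.toLinearMap.isLinear _)
    have := hpos j fun hji => hi (hji ▸ hj)
    rw [hm] at this
    show -t < m (a j)
    linarith
  intro hmem
  have h1 : -t < m (a i) := hsub hmem
  rw [hm] at hci
  linarith

variable [Finite ι]

theorem isExposed (h : RealizesAffineFunctions K a) {c : ι → ℝ} (hc : c ∈ K) (h0 : ∀ i, 0 ≤ c i) :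
    IsExposed ℝ (convexHull ℝ (range a)) (convexHull ℝ (a '' {i | c i = 0})) := by
  obtain ⟨t, m, hm⟩ := h.exists_eq c hc
  have h1 := isExposed_of_le a (-m) (M := t) fun i => by
    have := h0 i
    rw [hm] at this
    rw [neg_apply]
    linarith
  have h2 : {i | c i = 0} = {i | (-m) (a i) = t} := by
    ext i
    rw [mem_ofPred_eq, mem_ofPred_eq, hm, neg_apply]
    constructor <;> intro h <;> linarith
  rwa [h2]

/-- A supporting hyperplane is a nonnegative member of `K`, and its face is spanned by the zeros.
Members with a single zero make every `a i` a vertex outside the hull of the others. -/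
theorem isGaleDual [FiniteDimensional ℝ W] [Nonempty ι] (h : RealizesAffineFunctions K a)
    (hv : ∀ i, ∃ c ∈ K, c i = 0 ∧ ∀ j, j ≠ i → 0 < c j) {g : ι → V}
    (hg : ∀ J : Finset ι, J.Nonempty →
      (PositivelyDependent g J ↔ ∃ c ∈ K, (∀ i ∈ J, 0 < c i) ∧ ∀ i, i ∉ J → c i = 0)) :
    IsGaleDual g a := by
  have hinj : Function.Injective a := by
    intro i j hij
    by_contra hne
    refine h.notMem_convexHull hv (i := i) (J := {j}) hne ?_
    rw [hij]
    exact subset_convexHull ℝ _ (mem_image_of_mem a rfl)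
  refine ⟨?_, hinj, ?_, fun J hJ => ?_⟩
  · rw [interior_convexHull_nonempty_iff_affineSpan_eq_top]
    refine affineSpan_eq_top_of_forall_dual (range_nonempty a) fun φ hφ => ?_
    obtain ⟨i₀⟩ := ‹Nonempty ι›
    have := h.eq_zero (φ (a i₀)) (LinearMap.toContinuousLinearMap φ) fun i =>
      hφ _ (mem_range_self i) _ (mem_range_self i₀)
    simpa using this
  · refine Subset.antisymm (exposedPoints_subset_extremePoints.trans
      extremePoints_convexHull_subset) ?_
    rintro _ ⟨i, rfl⟩
    obtain ⟨c, hc, hci, hpos⟩ := hv i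
    rw [mem_exposedPoints_iff_exposed_singleton]
    have h1 := h.isExposed hc fun j => by
      by_cases hj : j = i
      · rw [hj, hci]
      · exact (hpos j hj).le
    have h2 : {j | c j = 0} = {i} := by
      ext j
      exact ⟨fun hj => by_contra fun hne => (hpos j hne).ne' hj, fun hj => hj ▸ hci⟩
    rwa [h2, image_singleton, convexHull_singleton] at h1
  · rw [hg J hJ]
    constructor
    · intro hexp
      rcases ((J : Set ι)ᶜ).eq_empty_or_nonempty with hemp | hne
      -- Here `J` contains every index and the face is empty; the constant function 1 serves.
      · refine ⟨_, h.mem 1 0, fun i _ => by simp, fun i hi => ?_⟩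
        have : i ∈ ((J : Set ι)ᶜ) := hi
        rw [hemp] at this
        exact this.elim
      · obtain ⟨M, m, hle, hA, -⟩ := exists_face_of_isExposed hexp
          (convexHull_nonempty_iff.2 (hne.image a))
        refine ⟨_, h.mem M (-m), fun i hi => ?_, fun i hi => ?_⟩
        · rw [neg_apply, ← sub_eq_add_neg, sub_pos]
          refine (hle i).lt_of_ne fun heq => h.notMem_convexHull hv (J := (J : Set ι)ᶜ)
            (fun h' => h' hi) (hA ▸ ⟨subset_convexHull ℝ _ (mem_range_self i), heq⟩)
        · have hmem : a i ∈ convexHull ℝ (a '' (J : Set ι)ᶜ) := subset_convexHull ℝ _ ⟨i, hi, rfl⟩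
          rw [hA] at hmem
          rw [neg_apply, hmem.2, add_neg_cancel]
    · rintro ⟨c, hc, hpos, h0⟩
      have h1 := h.isExposed hc fun i => by
        by_cases hi : i ∈ J
        · exact (hpos i hi).le
        · exact (h0 i hi).ge
      have h2 : {i | c i = 0} = (J : Set ι)ᶜ := by
        ext i
        exact ⟨fun hi hiJ => (hpos i hiJ).ne' hi, fun hi => h0 i hi⟩
      rwa [h2] at h1

theorem isSimplicial (h : RealizesAffineFunctions K a)
    (haff : ∀ c ∈ K, (∀ i, 0 ≤ c i) → c ≠ 0 →
      AffineIndependent ℝ fun i : {i // c i = 0} => a i) :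
    IsSimplicial (convexHull ℝ (range a)) := by
  intro A hA hne
  rcases A.eq_empty_or_nonempty with rfl | hnem
  · have : IsEmpty (vertexSet (∅ : Set W)) := ⟨fun x => (exposedPoints_subset x.2).elim⟩
    exact affineIndependent_of_subsingleton ℝ _
  · obtain ⟨M, m, hle, -, hA'⟩ := exists_face_of_isExposed hA hnem
    have h1 := haff _ (h.mem M (-m)) (fun i => by
      rw [neg_apply]; linarith [hle i]) (fun h0 => hne ?_)
    · refine h1.range.mono ?_
      rw [hA']
      refine (exposedPoints_subset_extremePoints.trans extremePoints_convexHull_subset).trans ?_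
      rintro _ ⟨i, hi, rfl⟩
      refine ⟨⟨i, ?_⟩, rfl⟩
      rw [neg_apply, show m (a i) = M from hi, add_neg_cancel]
    · rw [hA']
      congr 1
      rw [← image_univ]
      congr 1
      refine eq_univ_of_forall fun i => ?_
      have := congrFun h0 i
      rw [neg_apply, Pi.zero_apply] at this
      show m (a i) = M
      linarith

end RealizesAffineFunctions

end GaleDuality

/-! ### Existence of the Gale dual polytope -/

section GaleExistence

variable {ι V W : Type*} [NormedAddCommGroup V] [NormedSpace ℝ V]
  [NormedAddCommGroup W] [NormedSpace ℝ W]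

/-- Any `dim V` members of the configuration are linearly independent. -/
def InGeneralPosition {ι V : Type*} [AddCommGroup V] [Module ℝ V] (g : ι → V) : Prop :=
  ∀ J : Finset ι, J.card = Module.finrank ℝ V → LinearIndependent ℝ fun j : J => g j

/-- Fewer than `dim V` vectors in general position are independent, so the support of a nontrivial
dependency contains a basis. -/
theorem InGeneralPosition.eq_zero_of_dependent [Fintype ι] [FiniteDimensional ℝ V] {g : ι → V}
    (hg : InGeneralPosition g) (hcard : Module.finrank ℝ V ≤ Fintype.card ι) {b : ι → ℝ}
    (hb : b ≠ 0) (hsum : ∑ i, b i • g i = 0) (φ : Module.Dual ℝ V)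
    (hφ : ∀ i, b i ≠ 0 → φ (g i) = 0) : φ = 0 := by
  classical
  let J : Finset ι := Finset.univ.filter fun i => b i ≠ 0
  rcases le_total (Module.finrank ℝ V) J.card with hle | hle
  · obtain ⟨I, hIJ, hI⟩ := Finset.exists_subset_card_eq hle
    have hspan := (hg I hI).span_eq_top_of_card_eq_finrank' (by simpa using hI)
    refine LinearMap.ext_on_range hspan fun i => ?_
    exact hφ i (Finset.mem_filter.1 (hIJ i.2)).2
  · obtain ⟨I, hJI, -, hI⟩ := Finset.exists_subsuperset_card_eq (Finset.subset_univ J) hle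
      (by simpa using hcard)
    exfalso
    have h1 : ∑ i : I, b i • g i = 0 := by
      rw [Finset.sum_coe_sort I fun i => b i • g i, ← hsum]
      refine Finset.sum_subset (Finset.subset_univ I) fun i _ hi => ?_
      have : b i = 0 := by
        by_contra h0
        exact hi (hJI (Finset.mem_filter.2 ⟨Finset.mem_univ i, h0⟩))
      rw [this, zero_smul]
    have h2 := Fintype.linearIndependent_iff.1 (hg I hI) (fun i => b i) h1
    refine hb (funext fun i => ?_)
    by_contra h0
    exact h0 (h2 ⟨i, hJI (Finset.mem_filter.2 ⟨Finset.mem_univ i, h0⟩)⟩)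

theorem IsGaleTransform.exists_dependency [Fintype ι] [DecidableEq ι] {g : ι → V}
    (hg : IsGaleTransform g) (i : ι) :
    ∃ b : ι → ℝ, b i = 0 ∧ (∀ j, j ≠ i → 0 < b j) ∧ ∑ j, b j • g j = 0 := by
  obtain ⟨c, hc, hsum⟩ := hg i (-∑ j ∈ Finset.univ.erase i, g j)
  refine ⟨fun j => if j = i then 0 else 1 + c j, by simp, fun j hj => ?_, ?_⟩
  · have := hc j (Finset.mem_erase.2 ⟨hj, Finset.mem_univ j⟩)
    simp only [hj, if_false]
    linarith
  · rw [← Finset.add_sum_erase _ _ (Finset.mem_univ i)]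
    simp only [if_true, zero_smul, zero_add]
    rw [Finset.sum_congr rfl fun j hj => by rw [if_neg (Finset.ne_of_mem_erase hj), add_smul,
      one_smul], Finset.sum_add_distrib, hsum, add_neg_cancel]

theorem IsGaleTransform.exists_pos_dependency [Fintype ι] [DecidableEq ι] [Nonempty ι] {g : ι → V}
    (hg : IsGaleTransform g) : ∃ b : ι → ℝ, (∀ j, 0 < b j) ∧ ∑ j, b j • g j = 0 := by
  obtain ⟨i⟩ := ‹Nonempty ι›
  obtain ⟨c, hc, hsum⟩ := hg i (-∑ j, g j)
  refine ⟨fun j => 1 + if j = i then 0 else c j, fun j => ?_, ?_⟩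
  · dsimp only
    split_ifs with hj
    · norm_num
    · have := hc j (Finset.mem_erase.2 ⟨hj, Finset.mem_univ j⟩)
      linarith
  · simp only [add_smul, one_smul, Finset.sum_add_distrib]
    rw [← Finset.add_sum_erase _ (fun j => (if j = i then 0 else c j) • g j) (Finset.mem_univ i)]
    simp only [if_true, zero_smul, zero_add]
    have h1 : ∑ j ∈ Finset.univ.erase i, (if j = i then 0 else c j) • g j =
        ∑ j ∈ Finset.univ.erase i, c j • g j :=
      Finset.sum_congr rfl fun j hj => by rw [if_neg (Finset.ne_of_mem_erase hj)]
    rw [h1, hsum, add_neg_cancel]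

theorem IsGaleTransform.exists_isGaleDual [Fintype ι] [DecidableEq ι] [Nonempty ι]
    [FiniteDimensional ℝ V] [FiniteDimensional ℝ W] {g : ι → V} (hg : IsGaleTransform g)
    (hcard : Fintype.card ι = Module.finrank ℝ V + Module.finrank ℝ W + 1) :
    ∃ a : ι → W, IsGaleDual g a ∧
      (InGeneralPosition g → IsSimplicial (convexHull ℝ (range a))) := by
  obtain ⟨b, hb, hbsum⟩ := hg.exists_pos_dependency
  -- Rescaling by a strictly positive dependency `b` puts the constant function 1 in the kernel,
  -- without affecting the signs of dependencies.
  let Γ : (ι → ℝ) →ₗ[ℝ] V := Fintype.linearCombination ℝ fun i => b i • g i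
  have hK : ∀ c, c ∈ LinearMap.ker Γ ↔ ∑ i, (c i * b i) • g i = 0 := fun c => by
    rw [LinearMap.mem_ker, Fintype.linearCombination_apply]
    simp only [mul_smul]
  have hdiv : ∀ c : ι → ℝ, ∑ i, c i • g i = 0 → (fun i => c i / b i) ∈ LinearMap.ker Γ := by
    intro c hc
    rw [hK]
    simp only [div_mul_cancel₀ _ (hb _).ne', hc]
  have hΓ : LinearMap.range Γ = ⊤ := by
    refine LinearMap.range_eq_top.2 fun x => ?_
    obtain ⟨i⟩ := ‹Nonempty ι›
    obtain ⟨c, -, rfl⟩ := hg i x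
    refine ⟨fun j => if j = i then 0 else c j / b j, ?_⟩
    rw [Fintype.linearCombination_apply, ← Finset.add_sum_erase _ _ (Finset.mem_univ i)]
    simp only [if_true, zero_smul, zero_add]
    refine Finset.sum_congr rfl fun j hj => ?_
    rw [if_neg (Finset.ne_of_mem_erase hj), smul_smul, div_mul_cancel₀ _ (hb j).ne']
  have hrank : Module.finrank ℝ (LinearMap.ker Γ) = Module.finrank ℝ W + 1 := by
    have h1 := Γ.finrank_range_add_finrank_ker
    rw [hΓ, finrank_top, Module.finrank_fintype_fun_eq_card, hcard] at h1
    omega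
  obtain ⟨a, ha⟩ := exists_realizesAffineFunctions (W := W)
    ((hK 1).2 (by simpa using hbsum)) hrank
  refine ⟨a, ha.isGaleDual (fun i => ?_) (fun J hJ => ?_), fun hgen => ha.isSimplicial ?_⟩
  · obtain ⟨c, hci, hc, hsum⟩ := hg.exists_dependency i
    exact ⟨_, hdiv c hsum, by rw [hci, zero_div], fun j hj => div_pos (hc j hj) (hb j)⟩
  · constructor
    · intro hJdep
      obtain ⟨c, hc, hsum⟩ := exists_pos_of_positivelyDependent hJdep
      refine ⟨_, hdiv (fun i => if i ∈ J then c i else 0) ?_, fun i hi => ?_, fun i hi => ?_⟩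
      · simpa [ite_smul, Finset.sum_ite_mem] using hsum
      · simpa [hi] using div_pos (hc i hi) (hb i)
      · simp [hi]
    · rintro ⟨c, hc, hpos, h0⟩
      refine positivelyDependent_of_pos hJ (c := fun i => c i * b i)
        (fun j hj => mul_pos (hpos j hj) (hb j)) ?_
      rw [← (hK c).1 hc]
      exact Finset.sum_subset (Finset.subset_univ J) fun i _ hi => by
        rw [h0 i hi, zero_mul, zero_smul]
  · intro c hc hc0 hcne
    rw [affineIndependent_iff]
    intro s w hw hwa
    -- An affine dependency on the face is a functional vanishing on the kernel of `Γ`, so it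
    -- factors through `Γ` as some `φ` on `V`. It ignores the indices where `c ≠ 0`, so `φ` kills
    -- the support of a dependency and must vanish.
    let ω : Module.Dual ℝ (ι → ℝ) := ∑ e ∈ s, w e • LinearMap.proj e.1
    have hω : ∀ x, ω x = ∑ e ∈ s, w e * x e.1 := fun x => by simp [ω]
    have hωK : ω ∈ (LinearMap.ker Γ).dualAnnihilator := by
      rw [Submodule.mem_dualAnnihilator]
      intro x hx
      obtain ⟨t, m, hm⟩ := ha.exists_eq x hx
      have h1 := congrArg m hwa
      simp only [map_sum, map_smul, smul_eq_mul, map_zero] at h1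
      rw [hω]
      simp only [hm, mul_add, Finset.sum_add_distrib, ← Finset.sum_mul, hw, h1, zero_mul, add_zero]
    rw [← LinearMap.range_dualMap_eq_dualAnnihilator_ker] at hωK
    obtain ⟨φ, hφ⟩ := hωK
    have hφω : ∀ i, φ (g i) * b i = ω (Pi.single i 1) := fun i => by
      rw [← hφ, LinearMap.dualMap_apply, Fintype.linearCombination_apply_single, one_smul,
        map_smul, smul_eq_mul, mul_comm]
    have hφ0 : φ = 0 := by
      refine hgen.eq_zero_of_dependent (by omega) (b := fun i => c i * b i) (fun h0 => hcne ?_)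
        ((hK c).1 hc) φ fun i hi => ?_
      · exact funext fun i => (mul_eq_zero.1 (congrFun h0 i)).resolve_right (hb i).ne'
      · have h1 : ω (Pi.single i 1) = 0 := by
          rw [hω]
          refine Finset.sum_eq_zero fun e _ => ?_
          rw [Pi.single_eq_of_ne, mul_zero]
          rintro rfl
          exact hi (by simp [e.2])
        exact (mul_eq_zero.1 ((hφω i).trans h1)).resolve_right (hb i).ne'
    intro e he
    have h1 := hφω e.1
    rw [hφ0, LinearMap.zero_apply, zero_mul, hω, Finset.sum_eq_single e] at h1
    · simpa using h1.symm
    · intro e' _ hne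
      rw [Pi.single_eq_of_ne fun h' => hne (Subtype.ext h'), mul_zero]
    · exact fun h' => absurd he h'

end GaleExistence

/-! ### General position along a moment curve -/

section GeneralPosition

open Polynomial in
-- The determinant is a polynomial in `t` whose coefficient in the top possible degree is `det B`,
-- so it has finitely many roots.
theorem eventually_det_add_smul_ne_zero {n : Type*} [Fintype n] [DecidableEq n]
    (A B : Matrix n n ℝ) (hB : B.det ≠ 0) : ∀ᶠ t : ℝ in Filter.cofinite, (A + t • B).det ≠ 0 := by
  set p : ℝ[X] := ((X : ℝ[X]) • B.map C + A.map C).det with hp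
  have hp0 : p ≠ 0 := fun h0 => hB (by
    rw [← coeff_det_X_add_C_card B A, ← hp, h0, coeff_zero])
  refine (p.finite_setOfPred_isRoot hp0).subset fun t ht => ?_
  have ht' : (A + t • B).det = 0 := by simpa using ht
  have : p.eval t = (A + t • B).det := by
    rw [hp, ← coe_evalRingHom, RingHom.map_det]
    congr 1
    ext i j
    simp
    ring
  exact this.trans ht'

theorem exists_eventually_inGeneralPosition {ι V : Type*} [Finite ι] [AddCommGroup V] [Module ℝ V]
    [FiniteDimensional ℝ V] (g : ι → V) :
    ∃ h : ι → V, ∀ᶠ t : ℝ in Filter.cofinite, InGeneralPosition fun i => g i + t • h i := by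
  classical
  have := Fintype.ofFinite ι
  let n := Module.finrank ℝ V
  let e : V ≃ₗ[ℝ] (Fin n → ℝ) := LinearEquiv.ofFinrankEq _ _ (by simp [n])
  let x : ι → ℝ := fun i => (Fintype.equivFin ι i : ℕ)
  have hx : Function.Injective x := fun i j hij => by simpa [x, Fin.val_inj] using hij
  -- Points on the moment curve: any `n` of them have a nonzero Vandermonde determinant.
  let y : ι → Fin n → ℝ := fun i r => x i ^ (r : ℕ)
  refine ⟨fun i => e.symm (y i), ?_⟩
  have key : ∀ σ : Fin n → ι, Function.Injective σ → ∀ᶠ t : ℝ in Filter.cofinite,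
      LinearIndependent ℝ fun r => g (σ r) + t • e.symm (y (σ r)) := by
    intro σ hσ
    have hdet : (Matrix.of fun r => y (σ r)).det ≠ 0 :=
      Matrix.det_vandermonde_ne_zero_iff.2 (hx.comp hσ)
    filter_upwards [eventually_det_add_smul_ne_zero (Matrix.of fun r => e (g (σ r))) _ hdet]
      with t ht
    have h1 := Matrix.linearIndependent_rows_iff_isUnit.2
      ((Matrix.isUnit_iff_isUnit_det _).2 (isUnit_iff_ne_zero.2 ht))
    have h2 := h1.map' e.symm.toLinearMap e.symm.ker
    have h3 : (fun r => g (σ r) + t • e.symm (y (σ r))) = e.symm.toLinearMap ∘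
        ((Matrix.of fun r => e (g (σ r))) + t • Matrix.of fun r => y (σ r)).row := by
      funext r
      show _ = e.symm (e (g (σ r)) + t • y (σ r))
      rw [map_add, map_smul, e.symm_apply_apply]
    rw [h3]
    exact h2
  have hall := (Filter.eventually_all (l := Filter.cofinite)).2
    fun σ : {σ : Fin n → ι // Function.Injective σ} => key σ.1 σ.2
  filter_upwards [hall] with t ht J hJ
  let τ := J.equivFinOfCardEq hJ
  have h1 := ht ⟨fun r => τ.symm r, Subtype.val_injective.comp τ.symm.injective⟩
  have h2 := h1.comp τ τ.injective
  simpa [Function.comp_def] using h2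

end GeneralPosition

/-! ### Stability of vertex systems -/

namespace IsVertexSystem

open Filter Topology

variable {ι κ E : Type*} [NormedAddCommGroup E] [NormedSpace ℝ E]
  {x₀ : E} {l : ι × κ → StrongDual ℝ E} {v : (ι → κ) → E}
  [Fintype ι] [Fintype κ] [DecidableEq ι] [DecidableEq κ] [FiniteDimensional ℝ E]

/-- The vertex at which the inequalities `l s` with `s.2 ≠ f s.1` are tight depends continuously on
the functionals. -/
theorem exists_continuousAt_vertex (h : IsVertexSystem x₀ l v)
    (hE : Module.finrank ℝ E = Fintype.card ι * (Fintype.card κ - 1)) (f : ι → κ) :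
    ∃ V : (ι × κ → StrongDual ℝ E) → E, ContinuousAt V l ∧ V l = v f ∧
      ∀ᶠ l' in 𝓝 l, ∀ s : ι × κ, s.2 ≠ f s.1 → l' s (V l' - x₀) = 1 := by
  let τ := {s : ι × κ // s.2 ≠ f s.1}
  let T : (ι × κ → StrongDual ℝ E) → E →L[ℝ] (τ → ℝ) := fun l' =>
    ContinuousLinearMap.pi fun s => l' s.1
  have hT : Continuous T := by
    have h1 : T = fun l' => ∑ s : τ,
        (ContinuousLinearMap.single ℝ (fun _ : τ => ℝ) s).comp (l' s.1) := by
      funext l'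
      ext x t
      simp [T, Finset.sum_apply, Pi.single_apply]
    rw [h1]
    exact continuous_finsetSum _ fun s _ => continuous_const.clm_comp (continuous_apply s.1)
  have hinj : Function.Injective (T l).toLinearMap := by
    rw [← LinearMap.ker_eq_bot, LinearMap.ker_eq_bot']
    exact fun x hx => h.eq_zero_of_forall_tight hE f fun s hs => congrFun hx ⟨s, hs⟩
  let e : E ≃L[ℝ] (τ → ℝ) := (LinearEquiv.ofInjectiveOfFinrankEq (T l).toLinearMap hinj (by
    rw [Module.finrank_fintype_fun_eq_card, card_tight, hE])).toContinuousLinearEquiv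
  have he : (e : E →L[ℝ] (τ → ℝ)) = T l := rfl
  -- The vertex solves `T l' (x - x₀) = 1`, with right side the all-ones vector. Inversion is
  -- continuous at the invertible map `T l`, and nearby maps remain invertible.
  have hcont : ContinuousAt (fun l' => (T l').inverse) l := by
    have h1 : ContinuousAt (ContinuousLinearMap.inverse : (E →L[ℝ] (τ → ℝ)) → _) (T l) :=
      he ▸ (contDiffAt_map_inverse (n := 0) e).continuousAt
    exact h1.comp hT.continuousAt
  refine ⟨fun l' => (T l').inverse 1 + x₀,
    (hcont.clm_apply continuousAt_const).add continuousAt_const, ?_, ?_⟩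
  · have h1 : e (v f - x₀) = 1 := funext fun s => h.tight f s.1 s.2
    show (T l).inverse 1 + x₀ = v f
    rw [← he, ContinuousLinearMap.inverse_equiv, ← h1]
    simp
  · filter_upwards [hT.continuousAt.eventually (he ▸ e.nhds)] with l' hl' s hs
    obtain ⟨e', he'⟩ := hl'
    have h1 : T l' ((T l').inverse 1) = 1 := by
      rw [← he', ContinuousLinearMap.inverse_equiv]
      simp
    rw [add_sub_cancel_right]
    exact congrFun h1 ⟨s, hs⟩

theorem eventually_exists (h : IsVertexSystem x₀ l v)
    (hE : Module.finrank ℝ E = Fintype.card ι * (Fintype.card κ - 1))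
    (m : (ι → κ) → StrongDual ℝ E) (hm : ∀ f s, s.2 ≠ f s.1 → m f (edge v f s) < 0) :
    ∀ᶠ l' in 𝓝 l, ∃ v', IsVertexSystem x₀ l' v' ∧
      ∀ f s, s.2 ≠ f s.1 → m f (edge v' f s) < 0 := by
  choose V hV hVl htight using h.exists_continuousAt_vertex hE
  have hslack : ∀ᶠ l' in 𝓝 l, ∀ f, ∀ s : ι × κ, s.2 = f s.1 → l' s (V f l' - x₀) < 1 := by
    refine eventually_all.2 fun f => eventually_all.2 fun s => eventually_imp_distrib_left.2
      fun hs => ?_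
    have hc : ContinuousAt (fun l' : ι × κ → StrongDual ℝ E => l' s (V f l' - x₀)) l :=
      (continuous_apply s).continuousAt.clm_apply ((hV f).sub continuousAt_const)
    exact hc.eventually_lt continuousAt_const (by rw [hVl]; exact h.slack f s hs)
  have hedge : ∀ᶠ l' in 𝓝 l, ∀ f, ∀ s : ι × κ, s.2 ≠ f s.1 →
      m f (edge (fun f => V f l') f s) < 0 := by
    refine eventually_all.2 fun f => eventually_all.2 fun s => eventually_imp_distrib_left.2
      fun hs => ?_
    have hc : ContinuousAt (fun l' => m f (edge (fun f => V f l') f s)) l :=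
      (m f).continuous.continuousAt.comp ((hV _).sub (hV f))
    refine hc.eventually_lt continuousAt_const ?_
    simp only [hVl]
    exact hm f s hs
  filter_upwards [eventually_all.2 htight, hslack, hedge] with l' h1 h2 h3
  exact ⟨fun f => V f l', ⟨h1, h2⟩, h3⟩

end IsVertexSystem

/-! ### From the face lattice to a vertex system -/

section SimplexProduct

variable {r n : ℕ}

theorem isExposed_simplexProduct (I : Set (Fin r × Fin (n + 1))) :
    IsExposed ℝ (simplexProduct r n) {x ∈ simplexProduct r n | ∀ s ∈ I, x s.1 s.2 = 0} := by
  classical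
  rintro ⟨w, hw⟩
  let m : StrongDual ℝ (Fin r → Fin (n + 1) → ℝ) :=
    -∑ s with s ∈ I, (ContinuousLinearMap.proj (R := ℝ) (φ := fun _ : Fin (n + 1) => ℝ) s.2).comp
      (ContinuousLinearMap.proj (R := ℝ) (φ := fun _ : Fin r => Fin (n + 1) → ℝ) s.1)
  have hm : ∀ x, m x = -∑ s with s ∈ I, x s.1 s.2 := fun x => by simp [m]
  have hnonneg : ∀ x ∈ simplexProduct r n, ∀ s : Fin r × Fin (n + 1), 0 ≤ x s.1 s.2 :=
    fun x hx s => (hx s.1 (mem_univ _)).1 s.2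
  refine ⟨m, Subset.antisymm (fun x hx => ⟨hx.1, fun y hy => ?_⟩) fun x hx => ⟨hx.1, ?_⟩⟩
  · rw [hm, hm, Finset.sum_eq_zero fun s hs => hx.2 s (Finset.mem_filter.1 hs).2, neg_zero]
    exact neg_nonpos.2 (Finset.sum_nonneg fun s _ => hnonneg y hy s)
  · have h1 := hx.2 w hw.1
    rw [hm, hm, Finset.sum_eq_zero fun s hs => hw.2 s (Finset.mem_filter.1 hs).2, neg_zero] at h1
    have h2 := (Finset.sum_eq_zero_iff_of_nonneg fun s _ => hnonneg x hx.1 s).1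
      ((neg_nonneg.1 h1).antisymm (Finset.sum_nonneg fun s _ => hnonneg x hx.1 s))
    exact fun s hs => h2 s (by simpa using hs)

/-- A polytope that is combinatorially a product of simplices has points and supporting hyperplanes
with the incidences of the vertices and the facets of the product. -/
theorem CombEquiv.exists_incidence {E : Type*} [NormedAddCommGroup E] [NormedSpace ℝ E]
    {P : Set E} (hn : 0 < n) (h : CombEquiv P (simplexProduct r n)) :
    ∃ (m : Fin r × Fin (n + 1) → StrongDual ℝ E) (β : Fin r × Fin (n + 1) → ℝ)
      (v : (Fin r → Fin (n + 1)) → E),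
      (∀ f, v f ∈ P) ∧ (∀ s, ∀ x ∈ P, m s x ≤ β s) ∧ (∀ f s, m s (v f) = β s ↔ s.2 ≠ f s.1) := by
  classical
  obtain ⟨Φ⟩ := h
  let Z : Set (Fin r × Fin (n + 1)) → FaceLattice (simplexProduct r n) :=
    fun I => ⟨_, isExposed_simplexProduct I⟩
  have hne : ∀ A : FaceLattice P, (Φ A).1.Nonempty ↔ A.1.Nonempty := by
    intro A
    rw [← not_iff_not, not_nonempty_iff_eq_empty, not_nonempty_iff_eq_empty]
    constructor
    · intro hA
      have h1 : Φ A ≤ Φ ⟨∅, isExposed_empty⟩ := by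
        rw [← Subtype.coe_le_coe, hA]
        exact empty_subset _
      exact subset_empty_iff.1 (Φ.le_iff_le.1 h1)
    · intro hA
      have h1 : A ≤ Φ.symm ⟨∅, isExposed_empty⟩ := by
        rw [← Subtype.coe_le_coe, hA]
        exact empty_subset _
      exact subset_empty_iff.1 (Φ.le_symm_apply.1 h1)
  -- `Z (J f)` is the vertex of the product selected by `f`, and `Z {s}` is the facet of `s`. The
  -- point `v f` is any point of the face of `P` matching that vertex.
  let J : (Fin r → Fin (n + 1)) → Set (Fin r × Fin (n + 1)) := fun f => {s | s.2 ≠ f s.1}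
  have hvne : ∀ f, (Φ.symm (Z (J f))).1.Nonempty := by
    intro f
    rw [← hne, Φ.apply_symm_apply]
    refine ⟨fun i => Pi.single (f i) 1, fun i _ => single_mem_stdSimplex ℝ (f i), fun s hs => ?_⟩
    exact Pi.single_eq_of_ne hs 1
  choose v hv using hvne
  have hinc : ∀ f s, v f ∈ (Φ.symm (Z {s})).1 ↔ s.2 ≠ f s.1 := by
    intro f s
    constructor
    · intro hmem hs
      -- A common point would give a nonempty face of the product below both `Z (J f)` and `Z {s}`.
      -- On it all coordinates in the block of `s` vanish, although they sum to 1.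
      let A : FaceLattice P := ⟨_, (Φ.symm (Z (J f))).2.inter (Φ.symm (Z {s})).2⟩
      obtain ⟨x, hx⟩ := (hne A).2 ⟨v f, hv f, hmem⟩
      have h1 : Φ A ≤ Z (J f) := Φ.le_symm_apply.1 inter_subset_left
      have h2 : Φ A ≤ Z {s} := Φ.le_symm_apply.1 inter_subset_right
      have h3 := (h1 hx).2
      have h4 := (h2 hx).2 s rfl
      have h5 := ((h1 hx).1 s.1 (mem_univ _)).2
      rw [Finset.sum_eq_zero fun j _ => ?_] at h5
      · exact zero_ne_one h5
      · by_cases hj : j = f s.1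
        · rw [hj, ← hs]
          exact h4
        · exact h3 (s.1, j) hj
    · intro hs
      have h1 : Z (J f) ≤ Z {s} := fun x hx => ⟨hx.1, fun t ht => by
        rw [mem_singleton_iff.1 ht]
        exact hx.2 s hs⟩
      exact Φ.symm.monotone h1 (hv f)
  have hmax : ∀ s, ∃ (m : StrongDual ℝ E) (β : ℝ), (∀ x ∈ P, m x ≤ β) ∧
      ∀ x ∈ P, m x = β ↔ x ∈ (Φ.symm (Z {s})).1 := by
    intro s
    have : Nontrivial (Fin (n + 1)) := Fin.nontrivial_iff_two_le.2 (by omega)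
    obtain ⟨k, hk⟩ := exists_ne s.2
    have hmem := (hinc (fun _ => k) s).2 hk.symm
    obtain ⟨m, hm⟩ := (Φ.symm (Z {s})).2 ⟨_, hmem⟩
    have hmem' := hm ▸ hmem
    refine ⟨m, m (v fun _ => k), hmem'.2, fun x hx => ?_⟩
    rw [hm]
    exact ⟨fun h1 => ⟨hx, fun y hy => (hmem'.2 y hy).trans h1.ge⟩,
      fun h1 => (hmem'.2 x hx).antisymm (h1.2 _ hmem'.1)⟩
  choose m β hle heq using hmax
  have hvP : ∀ f, v f ∈ P := fun f => (Φ.symm (Z (J f))).2.subset (hv f)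
  exact ⟨m, β, v, hvP, hle, fun f s => (heq s _ (hvP f)).trans (hinc f s)⟩

end SimplexProduct

theorem IsVertexSystem.of_incidence {ι κ E : Type*} [NormedAddCommGroup E] [NormedSpace ℝ E]
    {m : ι × κ → StrongDual ℝ E} {β : ι × κ → ℝ} {v : (ι → κ) → E} {x₀ : E}
    (hle : ∀ s f, m s (v f) ≤ β s) (hinc : ∀ f s, m s (v f) = β s ↔ s.2 ≠ f s.1)
    (hx₀ : ∀ s, m s x₀ < β s) :
    IsVertexSystem x₀ (fun s => (β s - m s x₀)⁻¹ • m s) v := by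
  have hpos : ∀ s, 0 < β s - m s x₀ := fun s => sub_pos.2 (hx₀ s)
  refine ⟨fun f s hs => ?_, fun f s hs => ?_⟩
  · rw [smul_apply, map_sub, (hinc f s).2 hs, smul_eq_mul, inv_mul_cancel₀ (hpos s).ne']
  · have h1 : m s (v f) < β s := (hle s f).lt_of_ne fun h' => (hinc f s).1 h' hs
    rw [smul_apply, map_sub, smul_eq_mul, inv_mul_lt_iff₀ (hpos s)]
    linarith

theorem subset_polyhedron_of_le {τ E : Type*} [NormedAddCommGroup E] [NormedSpace ℝ E]
    {m : τ → StrongDual ℝ E} {β : τ → ℝ} {x₀ : E} {P : Set E} (hle : ∀ s, ∀ x ∈ P, m s x ≤ β s)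
    (hx₀ : ∀ s, m s x₀ < β s) : P ⊆ polyhedron x₀ fun s => (β s - m s x₀)⁻¹ • m s := by
  intro x hx s
  rw [smul_apply, map_sub, smul_eq_mul, inv_mul_le_iff₀ (sub_pos.2 (hx₀ s))]
  linarith [hle s x hx]

section Relabelling

variable {τ τ' E : Type*} [NormedAddCommGroup E] [NormedSpace ℝ E]

theorem polyhedron_comp_equiv (x₀ : E) (l : τ → StrongDual ℝ E) (e : τ' ≃ τ) :
    polyhedron x₀ (l ∘ e) = polyhedron x₀ l :=
  Set.ext fun _ => e.forall_congr_right (q := fun s => l s _ ≤ 1)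

theorem EnumeratesDualVertices.comp_equiv {P : Set E} {x₀ : E} {l : τ → StrongDual ℝ E}
    (h : EnumeratesDualVertices P x₀ l) (e : τ' ≃ τ) : EnumeratesDualVertices P x₀ (l ∘ e) :=
  ⟨h.1.comp e.injective, by rw [e.surjective.range_comp, h.2]⟩

theorem LabelledCombEquiv.comp_equiv {x₀ : E} {P P' : Set E} {l l' : τ → StrongDual ℝ E}
    (h : LabelledCombEquiv x₀ P l P' l') (e : τ' ≃ τ) :
    LabelledCombEquiv x₀ P (l ∘ e) P' (l' ∘ e) := by
  obtain ⟨φ, hφ⟩ := h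
  exact ⟨φ, fun A => congrArg (e ⁻¹' ·) (hφ A)⟩

end Relabelling

theorem isGaleTransform_projectedConfig {ι E F : Type*} [Fintype ι] [DecidableEq ι]
    [NormedAddCommGroup E] [NormedSpace ℝ E] [NormedAddCommGroup F] [NormedSpace ℝ F]
    [FiniteDimensional ℝ F] {q : F →L[ℝ] E} {l : ι → StrongDual ℝ E}
    (h : ∀ w, w ≠ 0 → ∀ i, ∃ j, j ≠ i ∧ 0 < l j (q w)) :
    IsGaleTransform (projectedConfig q l) := by
  refine fun i => positivelySpanning_of_forall_dual fun φ hφ => ?_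
  obtain ⟨w, hw⟩ := exists_eq_eval φ.toLinearMap
  replace hw : ∀ m, φ m = m w := hw
  obtain ⟨j, hj, hpos⟩ := h w (by
    rintro rfl
    exact hφ (ContinuousLinearMap.ext fun m => by simp [hw])) i
  exact ⟨j, Finset.mem_erase.2 ⟨hj, Finset.mem_univ j⟩, by rw [hw]; exact hpos⟩

theorem exists_comp_eq_of_injective {E F : Type*} [NormedAddCommGroup E] [NormedSpace ℝ E]
    [FiniteDimensional ℝ E] [NormedAddCommGroup F] [NormedSpace ℝ F] {q : F →L[ℝ] E}
    (hq : Function.Injective q) (φ : StrongDual ℝ F) : ∃ ψ : StrongDual ℝ E, ψ.comp q = φ := by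
  obtain ⟨p, hp⟩ := q.toLinearMap.exists_leftInverse_of_injective (LinearMap.ker_eq_bot.2 hq)
  refine ⟨LinearMap.toContinuousLinearMap (φ.toLinearMap ∘ₗ p), ContinuousLinearMap.ext fun x => ?_⟩
  exact congrArg φ (LinearMap.congr_fun hp x)

theorem mainTheorem5 (d : ℕ) (hd : 1 ≤ d)
    (P : Set (EuclideanSpace ℝ (Fin (d ^ 2))))
    (hP : IsPolytope P)
    (hcomb : CombEquiv P (simplexProduct d d))
    (π : EuclideanSpace ℝ (Fin (d ^ 2)) →L[ℝ] EuclideanSpace ℝ (Fin d))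
    (hπ : Function.Surjective π)
    (hvert : PreservesVertices π P)
    (q : EuclideanSpace ℝ (Fin (d ^ 2 - d)) →L[ℝ] EuclideanSpace ℝ (Fin (d ^ 2)))
    (hq : Function.Injective q)
    (hexact : Function.Exact q π) :
    (interior P).Nonempty ∧
    ∀ x₀ ∈ interior P,
      ∃ l : Fin (d * (d + 1)) → StrongDual ℝ (EuclideanSpace ℝ (Fin (d ^ 2))),
        EnumeratesDualVertices P x₀ l ∧
        -- the associated polytope of `P` itself
        IsGaleTransform (projectedConfig q l) ∧
        (∃ a : Fin (d * (d + 1)) → EuclideanSpace ℝ (Fin (2 * d - 1)),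
          IsGaleDual (projectedConfig q l) a) ∧
        -- after an arbitrarily small perturbation of the facets it is simplicial
        ∀ ε : ℝ, 0 < ε →
          ∃ l' : Fin (d * (d + 1)) → StrongDual ℝ (EuclideanSpace ℝ (Fin (d ^ 2))),
            (∀ i, ‖l' i - l i‖ < ε) ∧
            IsPolytope (polyhedron x₀ l') ∧
            EnumeratesDualVertices (polyhedron x₀ l') x₀ l' ∧
            LabelledCombEquiv x₀ P l (polyhedron x₀ l') l' ∧
            PreservesVertices π (polyhedron x₀ l') ∧
            IsGaleTransform (projectedConfig q l') ∧
            ∃ a : Fin (d * (d + 1)) → EuclideanSpace ℝ (Fin (2 * d - 1)),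
              IsGaleDual (projectedConfig q l') a ∧
              IsSimplicial (convexHull ℝ (range a)) := by
  classical
  have : NeZero d := ⟨by omega⟩
  have : Nontrivial (Fin (d + 1)) := Fin.nontrivial_iff_two_le.2 (by omega)
  have hE : Module.finrank ℝ (EuclideanSpace ℝ (Fin (d ^ 2))) =
      Fintype.card (Fin d) * (Fintype.card (Fin (d + 1)) - 1) := by simp [sq]
  obtain ⟨m, β, v, hvP, hle, hinc⟩ := hcomb.exists_incidence hd
  have hconv : Convex ℝ P := by
    obtain ⟨S, -, rfl⟩ := hP
    exact convex_convexHull ℝ S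
  -- The chain closes up: `P` lies in the polyhedron, which is the hull of the `v f`, which lies in
  -- the convex set `P`.
  have hPeq : ∀ x₀, (∀ s, m s x₀ < β s) →
      P = polyhedron x₀ fun s => (β s - m s x₀)⁻¹ • m s := fun x₀ hx₀ => by
    refine (subset_polyhedron_of_le hle hx₀).antisymm ?_
    rw [(IsVertexSystem.of_incidence (fun s f => hle s _ (hvP f)) hinc hx₀).polyhedron_eq hE]
    exact convexHull_min (range_subset_iff.2 hvP) hconv
  have hslack : ∀ s, ∃ f, m s (v f) < β s := fun s =>
    ⟨fun _ => s.2, (hle s _ (hvP _)).lt_of_ne fun h => (hinc _ s).1 h rfl⟩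
  refine ⟨?_, fun x₀ hx₀ => ?_⟩
  · let N : ℝ := Fintype.card (Fin d → Fin (d + 1))
    have hN : 0 < N := Nat.cast_pos.2 Fintype.card_pos
    -- The barycentre of the vertices is strictly inside, since each facet misses some vertex.
    have hx₀ : ∀ s, m s (N⁻¹ • ∑ f, v f) < β s := fun s => by
      obtain ⟨f, hf⟩ := hslack s
      rw [map_smul, map_sum, smul_eq_mul, inv_mul_lt_iff₀ hN]
      refine (Finset.sum_lt_sum (fun f _ => hle s _ (hvP f)) ⟨f, Finset.mem_univ f, hf⟩).trans_eq ?_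
      rw [Finset.sum_const, Finset.card_univ, nsmul_eq_mul]
    rw [hPeq _ hx₀]
    exact ⟨_, mem_interior_polyhedron _ _⟩
  · have hx₀β : ∀ s, m s x₀ < β s := fun s => by
      obtain ⟨f, hf⟩ := hslack s
      obtain ⟨k, hk⟩ := exists_ne s.2
      -- The functional is tight at one vertex and slack at another, so it is nonzero and hence
      -- open; interior points cannot attain its maximum.
      have hne : m s ≠ 0 := fun h0 => by
        have h1 := (hinc (fun _ => k) s).2 hk.symm
        rw [h0, zero_apply] at h1 hf
        exact hf.ne h1
      have h1 : m s '' interior P ⊆ interior (Iic (β s)) := interior_maximal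
        (image_subset_iff.2 fun x hx => hle s x (interior_subset hx))
        ((m s).isOpenMap_of_ne_zero hne _ isOpen_interior)
      rw [interior_Iic] at h1
      exact h1 (mem_image_of_mem _ hx₀)
    set l := fun s => (β s - m s x₀)⁻¹ • m s with hl
    have hsys : IsVertexSystem x₀ l v :=
      IsVertexSystem.of_incidence (fun s f => hle s _ (hvP f)) hinc hx₀β
    have hPl : P = polyhedron x₀ l := hPeq x₀ hx₀β
    rw [hPl] at hvert
    choose p hp using hsys.exists_of_preservesVertices hE hvert
    let e : Fin (d * (d + 1)) ≃ Fin d × Fin (d + 1) := finProdFinEquiv.symm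
    have hgale : ∀ {l' : Fin d × Fin (d + 1) → StrongDual ℝ (EuclideanSpace ℝ (Fin (d ^ 2)))}
        {v'}, IsVertexSystem x₀ l' v' →
        (∀ f s, s.2 ≠ f s.1 → p f (π (IsVertexSystem.edge v' f s)) < 0) →
        IsGaleTransform (projectedConfig q (l' ∘ e)) := by
      intro l' v' hsys' hp'
      refine isGaleTransform_projectedConfig fun w hw i => ?_
      obtain ⟨s, hs, hpos⟩ := hsys'.exists_ne_pos_apply hE hp'
        (fun h0 => hw (hq (by rw [h0, map_zero]))) (hexact.apply_apply_eq_zero w) (e i)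
      exact ⟨e.symm s, fun h0 => hs (by rw [← h0, e.apply_symm_apply]), by simpa using hpos⟩
    -- The count is `d(d+1) = (d² - d) + (2d - 1) + 1`; the truncated subtractions are exact because
    -- `1 ≤ d ≤ d * d`.
    have hcard : Fintype.card (Fin (d * (d + 1))) =
        Module.finrank ℝ (StrongDual ℝ (EuclideanSpace ℝ (Fin (d ^ 2 - d)))) +
          Module.finrank ℝ (EuclideanSpace ℝ (Fin (2 * d - 1))) + 1 := by
      rw [← LinearEquiv.finrank_eq (LinearMap.toContinuousLinearMap (𝕜 := ℝ)
        (E := EuclideanSpace ℝ (Fin (d ^ 2 - d))) (F' := ℝ)), Subspace.dual_finrank_eq,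
        finrank_euclideanSpace_fin, finrank_euclideanSpace_fin, Fintype.card_fin, sq, mul_add]
      have : d ≤ d * d := Nat.le_mul_self d
      omega
    have : Nonempty (Fin (d * (d + 1))) := e.nonempty
    refine ⟨l ∘ e, ?_, hgale hsys hp, ?_, fun ε hε => ?_⟩
    · rw [hPl]
      exact (hsys.enumeratesDualVertices hE).comp_equiv e
    · obtain ⟨a, ha, -⟩ := (hgale hsys hp).exists_isGaleDual hcard
      exact ⟨a, ha⟩
    · obtain ⟨h, hgen⟩ := exists_eventually_inGeneralPosition (projectedConfig q (l ∘ e))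
      -- The displacement `h` lives on the projected configuration; `H` lifts it to the facet
      -- functionals.
      choose H hH using fun i => exists_comp_eq_of_injective hq (h i)
      let L : ℝ → Fin d × Fin (d + 1) → StrongDual ℝ (EuclideanSpace ℝ (Fin (d ^ 2))) :=
        fun t s => l s + t • H (e.symm s)
      have hL : Filter.Tendsto L (nhdsWithin 0 {0}ᶜ) (nhds l) := by
        have h1 : Continuous L := continuous_pi fun s =>
          continuous_const.add (continuous_id.smul continuous_const)
        have h2 : L 0 = l := by
          funext s
          simp [L]
        exact h2 ▸ h1.continuousAt.tendsto.mono_left nhdsWithin_le_nhds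
      -- Closeness and stability hold for `t` near 0, general position for all but finitely many
      -- `t`; a punctured neighbourhood of 0 meets both requirements.
      obtain ⟨t, ⟨hball, v', hsys', hp'⟩, ht⟩ := ((hL.eventually
        ((Filter.eventually_mem_set.2 (Metric.ball_mem_nhds l hε)).and (hsys.eventually_exists hE
          (fun f => (p f).comp π) hp))).and (hgen.filter_mono (nhdsNE_le_cofinite 0))).exists
      have hgen' : InGeneralPosition (projectedConfig q (L t ∘ e)) := by
        convert ht using 2 with i
        rw [← hH i]
        ext x
        simp [projectedConfig, L]
      obtain ⟨a, ha, hsimp⟩ := (hgale hsys' hp').exists_isGaleDual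
        (W := EuclideanSpace ℝ (Fin (2 * d - 1))) hcard
      have hpoly : polyhedron x₀ (L t ∘ e) = polyhedron x₀ (L t) := polyhedron_comp_equiv x₀ _ e
      refine ⟨L t ∘ e, fun i => ?_, ?_, ?_, ?_, ?_, hgale hsys' hp', a, ha, hsimp hgen'⟩
      · rw [← dist_eq_norm]
        exact (dist_le_pi_dist (L t) l (e i)).trans_lt hball
      · rw [hpoly]
        exact hsys'.isPolytope_polyhedron hE
      · rw [hpoly]
        exact (hsys'.enumeratesDualVertices hE).comp_equiv e
      · rw [hpoly, hPl]
        exact (hsys.labelledCombEquiv hE hsys').comp_equiv e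
      · rw [hpoly]
        exact hsys'.preservesVertices hE π p hp'
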